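/- Let $m\ge 2$, let $\mathcal X_1,\dots,\mathcal X_m$ be finite sets, and let party $i\in[m]=\{1,\dots,m\}$ hold a quantum system $A_i$ with Hilbert space $\mathbb C^{\mathcal X_i}$ and computational basis $\{|x_i\rangle : x_i\in\mathcal X_i\}$. Let $$|\psi\rangle=\sum_{x_1,\dots,x_m}\psi_{x_1\ldots x_m}|x_1\rangle\cdots|x_m\rangle$$ be a unit vector in $A_1\otimes\cdots\otimes A_m$, and let $X_{[m]}=(X_1,\dots,X_m)$ be random variables with joint distribution $p(x_1,\dots,x_m)=|\psi_{x_1\ldots x_m}|^2$. For $I\subseteq[m]$ write $X_I=(X_i)_{i\in I}$; let $H$ be the Shannon entropy with binary logarithm and $H(X_I|X_J)=H(X_{I\cup J})-H(X_J)$. Let $\mathcal R_c$ be the set of $(R_1,\dots,R_m)\in\mathbb R^m$ with $$\sum_{j\in I}R_j\ \ge\ H(X_I|X_{[m]\setminus I})\qquad\text{for all } I\subsetneq[m].$$ GHZ distillation: let $|\Gamma_m\rangle=\frac1{\sqrt2}(|0\rangle^{\otimes m}+|1\rangle^{\otimes m})$. An LOCC channel consists of finitely many rounds; in each round one party applies an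 instrument with finitely many outcomes to its own finite-dimensional system and broadcasts the outcome, and the other parties apply local channels; all operations may depend on all earlier outcomes. A protocol for $\psi^{\otimes n}$ (party $i$ holding $A_i^{\otimes n}$) is an LOCC channel whose output $\sigma$ consists of $k$ qubits for each party; it is $\varepsilon$-accurate if $\frac12\bigl\|\sigma-|\Gamma_m\rangle\langle\Gamma_m|^{\otimes k}\bigr\|_1\le\varepsilon$, and its rate is $k/n$. A real number $R$ is achievable if for every $\varepsilon>0$ and all sufficiently large $n$ there is an $\varepsilon$-accurate protocol of rate at least $R-\varepsilon$. The GHZ distillation capacity $C_{\mathrm{GHZ}}(\psi)$ is the supremum of all achievable $R$. Then the minimum $R^c_{\mathrm{CO}}:=\min_{(R_1,\dots,R_m)\in\mathcal R_c}\sum_{j=1}^m R_j$ exists, and $$C_{\mathrm{GHZ}}(\psi)\ \ge\ H(X_{[m]})-R^c_{\mathrm{CO}}.$$ -/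

import Mathlib

open scoped Matrix

noncomputable section

namespace GHZ

/-! ### States and operators

A multipartite system with parties `Fin m` and local spaces `ℂ^{A i}` has the computational basis
`∀ i, A i`; vectors are functions on that basis and operators are matrices. -/

/-- The operator `|ψ⟩⟨ψ|`. -/
def proj {S : Type} (ψ : S → ℂ) : Matrix S S ℂ :=
  Matrix.vecMulVec ψ (star ψ)

/-- The trace norm `‖M‖₁`: the sum of the singular values of `M`. -/
def traceNorm {S : Type} [Fintype S] [DecidableEq S] (M : Matrix S S ℂ) : ℝ :=
  ∑ s, √((Matrix.isHermitian_conjTranspose_mul_self M).eigenvalues s)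

/-- The vector `ψ^{⊗ n}`, in which party `i` holds the `n` systems with basis `Fin n → X i`. -/
def tensorPower {m : ℕ} {X : Fin m → Type} (ψ : (∀ i, X i) → ℂ) (n : ℕ) :
    (∀ i, Fin n → X i) → ℂ :=
  fun x => ∏ t, ψ (fun i => x i t)

/-- The `m`-party GHZ vector `(|0…0⟩ + |1…1⟩) / √2`. -/
def ghz (m : ℕ) : (Fin m → Fin 2) → ℂ :=
  fun x => ((if x = fun _ => 0 then 1 else 0) + (if x = fun _ => 1 then 1 else 0)) /
    ((√2 : ℝ) : ℂ)

/-- The tensor product `⊗ᵢ K i` of local operators. -/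
def tensorOp {m : ℕ} {A B : Fin m → Type} (K : ∀ i, Matrix (B i) (A i) ℂ) :
    Matrix (∀ i, B i) (∀ i, A i) ℂ :=
  Matrix.of fun b a => ∏ i, K i (b i) (a i)

/-- The completely positive map `ρ ↦ ∑ₖ Kₖ ρ Kₖ†`. -/
def krausMap {S T κ : Type} [Fintype S] [Fintype κ] (K : κ → Matrix T S ℂ) :
    Matrix S S ℂ →ₗ[ℂ] Matrix T T ℂ where
  toFun ρ := ∑ k, K k * ρ * (K k)ᴴ
  map_add' ρ σ := by
    simp only [Matrix.mul_add, Matrix.add_mul, Finset.sum_add_distrib]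
  map_smul' c ρ := by
    simp only [Matrix.mul_smul, Matrix.smul_mul, Finset.smul_sum, RingHom.id_apply]

/-- The tensor product of local completely positive maps, the one of party `j` having the Kraus
operators `K j k`. -/
def localMap {m : ℕ} {A B : Fin m → Type} [∀ j, Fintype (A j)] {κ : Type} [Fintype κ]
    (K : ∀ j, κ → Matrix (B j) (A j) ℂ) :
    Matrix (∀ j, A j) (∀ j, A j) ℂ →ₗ[ℂ] Matrix (∀ j, B j) (∀ j, B j) ℂ :=
  krausMap fun f : Fin m → κ => tensorOp fun j => K j (f j)

/-- LOCC channels with finitely many rounds. In a round, party `i` applies an instrument with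
finitely many outcomes `u` and broadcasts `u`; the other parties apply local channels which may
depend on `u`. What follows may depend on `u` as well, and in the end `u` is forgotten. -/
inductive IsLOCC {m : ℕ} : ∀ (A B : Fin m → Type) [∀ j, Fintype (A j)] [∀ j, DecidableEq (A j)]
    [∀ j, Fintype (B j)] [∀ j, DecidableEq (B j)],
    (Matrix (∀ j, A j) (∀ j, A j) ℂ →ₗ[ℂ] Matrix (∀ j, B j) (∀ j, B j) ℂ) → Prop
  | done (A : Fin m → Type) [∀ j, Fintype (A j)] [∀ j, DecidableEq (A j)] :
      IsLOCC A A LinearMap.id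
  | round {A C B : Fin m → Type} [∀ j, Fintype (A j)] [∀ j, DecidableEq (A j)]
      [∀ j, Fintype (C j)] [∀ j, DecidableEq (C j)]
      [∀ j, Fintype (B j)] [∀ j, DecidableEq (B j)]
      {U κ : Type} [Fintype U] [Fintype κ] (i : Fin m)
      (K : U → ∀ j, κ → Matrix (C j) (A j) ℂ)
      (instrument : ∑ u, ∑ k, (K u i k)ᴴ * K u i k = 1)
      (channel : ∀ u, ∀ j, j ≠ i → ∑ k, (K u j k)ᴴ * K u j k = 1)
      (Λ : U → (Matrix (∀ j, C j) (∀ j, C j) ℂ →ₗ[ℂ] Matrix (∀ j, B j) (∀ j, B j) ℂ))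
      (next : ∀ u, IsLOCC C B (Λ u)) :
      IsLOCC A B (∑ u, Λ u ∘ₗ localMap (K u))

/-- `ψ^{⊗ n}` can be converted by LOCC to `k` copies of the GHZ state with trace distance at
most `ε`. -/
def IsAccurate {m : ℕ} {X : Fin m → Type} [∀ i, Fintype (X i)] [∀ i, DecidableEq (X i)]
    (ψ : (∀ i, X i) → ℂ) (n k : ℕ) (ε : ℝ) : Prop :=
  ∃ Λ : Matrix (∀ i, Fin n → X i) (∀ i, Fin n → X i) ℂ →ₗ[ℂ]
      Matrix (Fin m → Fin k → Fin 2) (Fin m → Fin k → Fin 2) ℂ,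
    IsLOCC (fun i => Fin n → X i) (fun _ => Fin k → Fin 2) Λ ∧
    (1 / 2 : ℝ) * traceNorm (Λ (proj (tensorPower ψ n)) - proj (tensorPower (ghz m) k)) ≤ ε

/-- `R` is an achievable rate of GHZ distillation from `ψ`: for every `ε > 0` and all sufficiently
large `n` there is an `ε`-accurate protocol on `n` copies with conversion rate at least `R - ε`. -/
def IsAchievable {m : ℕ} {X : Fin m → Type} [∀ i, Fintype (X i)] [∀ i, DecidableEq (X i)]
    (ψ : (∀ i, X i) → ℂ) (R : ℝ) : Prop :=
  ∀ ε : ℝ, 0 < ε → ∀ᶠ n : ℕ in Filter.atTop, ∃ k : ℕ,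
    IsAccurate ψ n k ε ∧ R - ε ≤ (k : ℝ) / (n : ℝ)

/-- The GHZ distillation capacity: the supremum of the achievable rates (taken in the extended
reals, so that it is a genuine supremum in every case). -/
def capacity {m : ℕ} {X : Fin m → Type} [∀ i, Fintype (X i)] [∀ i, DecidableEq (X i)]
    (ψ : (∀ i, X i) → ℂ) : EReal :=
  sSup {c : EReal | ∃ R : ℝ, IsAchievable ψ R ∧ c = (R : EReal)}

/-! ### Entropies and communication for omniscience -/

/-- The distribution of the outcomes of measuring `ψ` in the computational basis. -/
def basisDist {S : Type} (ψ : S → ℂ) : S → ℝ :=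
  fun x => ‖ψ x‖ ^ 2

/-- Shannon entropy in bits of a distribution on a finite set. -/
def entropy {S : Type} [Fintype S] (p : S → ℝ) : ℝ :=
  -∑ x, p x * Real.logb 2 (p x)

/-- The distribution of `X_I = (X_i : i ∈ I)` when `X_[m]` has distribution `p`. -/
def marginal {m : ℕ} {X : Fin m → Type} [∀ i, Fintype (X i)] [∀ i, DecidableEq (X i)]
    (p : (∀ i, X i) → ℝ) (I : Finset (Fin m)) : (∀ i : I, X i) → ℝ :=
  fun y => ∑ x with (fun i : I => x i) = y, p x

/-- The conditional entropy `H(X_I | X_J) = H(X_{I ∪ J}) - H(X_J)`. -/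
def condEntropy {m : ℕ} {X : Fin m → Type} [∀ i, Fintype (X i)] [∀ i, DecidableEq (X i)]
    (p : (∀ i, X i) → ℝ) (I J : Finset (Fin m)) : ℝ :=
  entropy (marginal p (I ∪ J)) - entropy (marginal p J)

/-- The region of rate tuples with `∑_{j ∈ I} R_j ≥ H(X_I | X_{[m] ∖ I})` for all `I ⊊ [m]`. -/
def rateRegion {m : ℕ} {X : Fin m → Type} [∀ i, Fintype (X i)] [∀ i, DecidableEq (X i)]
    (p : (∀ i, X i) → ℝ) : Set (Fin m → ℝ) :=
  {R | ∀ I : Finset (Fin m), I ⊂ Finset.univ → condEntropy p I Iᶜ ≤ ∑ j ∈ I, R j}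

/-- The sum rates of the tuples in the rate region. -/
def sumRates {m : ℕ} {X : Fin m → Type} [∀ i, Fintype (X i)] [∀ i, DecidableEq (X i)]
    (p : (∀ i, X i) → ℝ) : Set ℝ :=
  (fun R : Fin m → ℝ => ∑ j, R j) '' rateRegion p

/-- The minimal sum rate in the rate region. -/
def omniscienceRate {m : ℕ} {X : Fin m → Type} [∀ i, Fintype (X i)] [∀ i, DecidableEq (X i)]
    (p : (∀ i, X i) → ℝ) : ℝ :=
  sInf (sumRates p)

end GHZ

end

noncomputable section

namespace GHZ

/-! ### The trace norm of a sum of rank-one operators -/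

section TraceNorm

/-! The protocol is classical communication for omniscience carried out coherently. Fix a rate tuple
`R` in the region and a small `δ`. Each party measures, without destroying the superposition, a
random hash of its length-`n` basis string with about `2 ^ (n * (R j + δ))` values. The inequalities
for nonempty proper `I` say exactly that typical strings which differ precisely in the coordinates
`I` are rarely confused. So, off a set of small weight, the hash values and the string of any one
party determine all the other strings (`exists_good_hash`). The surviving superposition is therefore
GHZ-like: its basis states differ pairwise at every party.

The modulus of an amplitude of `ψ^{⊗ n}` depends only on the letter counts, which take polynomially
many values. Cut each cell (hash values, letter counts) into blocks of `2 ^ k` strings, dropping an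
incomplete remainder (`exists_blocks`). One party can measure the block index and remove the phases;
a local relabelling then turns the block into `k` GHZ copies exactly (`Distills.of_hashed_blocks`).
There are about `2 ^ (n * ∑ R j)` cells and each typical string has weight about `2 ^ (-n * H)`, so
the dropped weight vanishes when `k / n` is just below `H - ∑ R j` (`eventually_isAccurate`).

All losses are handled at once: the protocol is exact on the restriction of `ψ^{⊗ n}` to the good
strings, and the norm of the remaining part controls the trace distance (`isAccurate_of_distills`).
A compactness argument supplies a minimising `R` (`isLeast_omniscienceRate`). -/

lemma mul_proj_mul_conjTranspose {S T : Type} [Fintype S] (K : Matrix T S ℂ) (v : S → ℂ) :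
    K * proj v * Kᴴ = proj (K *ᵥ v) := by
  rw [proj, proj, Matrix.mul_vecMulVec, Matrix.vecMulVec_mul, Matrix.star_mulVec]

variable {S T κ : Type} [Fintype S] [Fintype T] [Fintype κ]

/-- The Euclidean norm of a vector of amplitudes. -/
def vnorm (v : S → ℂ) : ℝ := ‖WithLp.toLp 2 v‖

lemma vnorm_nonneg (v : S → ℂ) : 0 ≤ vnorm v := norm_nonneg _

lemma vnorm_sq (v : S → ℂ) : vnorm v ^ 2 = ∑ x, ‖v x‖ ^ 2 := by
  simp [vnorm, EuclideanSpace.norm_sq_eq]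

lemma vnorm_smul (c : ℂ) (v : S → ℂ) : vnorm (c • v) = ‖c‖ * vnorm v := by
  simp [vnorm, WithLp.toLp_smul, norm_smul]

lemma star_dotProduct_self (v : S → ℂ) : star v ⬝ᵥ v = ((vnorm v ^ 2 : ℝ) : ℂ) := by
  rw [vnorm_sq]
  simp [dotProduct, Complex.conj_mul']

-- With `v s` an eigenbasis of `Mᴴ * M`, the normalised nonzero images `w s` of the `v s` under `M`
-- are orthonormal and `√(lam s) = ⟨w s, M (v s)⟩`. Expanding `M` and summing over `s`,
-- Cauchy–Schwarz and Bessel bound the contribution of each rank-one term by the product of its two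
-- norms.
open scoped ComplexOrder in
lemma traceNorm_sum_vecMulVec_le [DecidableEq S] (a b : κ → S → ℂ) :
    traceNorm (∑ k, Matrix.vecMulVec (a k) (star (b k))) ≤ ∑ k, vnorm (a k) * vnorm (b k) := by
  set M := ∑ k, Matrix.vecMulVec (a k) (star (b k)) with hM
  set H := Matrix.isHermitian_conjTranspose_mul_self M
  set lam := H.eigenvalues
  set v := H.eigenvectorBasis
  have hlam : ∀ s, 0 ≤ lam s :=
    fun s => (Matrix.posSemidef_conjTranspose_mul_self M).eigenvalues_nonneg s
  let E := EuclideanSpace ℂ S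
  let Mv : S → E := fun s => WithLp.toLp 2 (M *ᵥ (v s).ofLp)
  have hMv : ∀ s, Mv s = ∑ k, inner ℂ (WithLp.toLp 2 (b k)) (v s) • WithLp.toLp 2 (a k) := by
    intro s
    ext x
    simp only [Mv, hM, Matrix.sum_mulVec, WithLp.ofLp_sum, Finset.sum_apply, PiLp.smul_apply,
      Matrix.vecMulVec_mulVec, EuclideanSpace.inner_eq_star_dotProduct]
    refine Finset.sum_congr rfl fun k _ => ?_
    simp [dotProduct_comm, mul_comm]
  have hinner : ∀ s t, inner ℂ (Mv s) (Mv t) = if s = t then (lam t : ℂ) else 0 := by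
    intro s t
    have h1 : inner ℂ (Mv s) (Mv t) = inner ℂ (v s) (WithLp.toLp 2 ((Mᴴ * M) *ᵥ (v t).ofLp)) := by
      change (M *ᵥ (v t).ofLp) ⬝ᵥ star (M *ᵥ (v s).ofLp) =
        ((Mᴴ * M) *ᵥ (v t).ofLp) ⬝ᵥ star (v s).ofLp
      rw [← Matrix.mulVec_mulVec, Matrix.star_mulVec, dotProduct_comm, ← Matrix.dotProduct_mulVec,
        dotProduct_comm]
    rw [h1, H.mulVec_eigenvectorBasis t]
    have h2 : WithLp.toLp 2 (lam t • (v t).ofLp) = (lam t : ℂ) • v t := by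
      ext x; simp
    rw [h2, inner_smul_right, orthonormal_iff_ite.mp v.orthonormal s t]
    simp
  let P := {s : S // lam s ≠ 0}
  let w : P → E := fun s => ((√(lam s) : ℝ) : ℂ)⁻¹ • Mv s
  have hw : Orthonormal ℂ w := by
    rw [orthonormal_iff_ite]
    intro s t
    simp only [w, inner_smul_left, inner_smul_right, hinner]
    by_cases h : s = t
    · subst h
      have h0 : √(lam s) ≠ 0 := (Real.sqrt_ne_zero (hlam _)).mpr s.2
      have h1 : ((√(lam s) : ℝ) : ℂ) ≠ 0 := by exact_mod_cast h0
      have h2 : (lam s : ℂ) = (√(lam s) : ℝ) * (√(lam s) : ℝ) := by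
        rw [← Complex.ofReal_mul, Real.mul_self_sqrt (hlam _)]
      rw [h2]
      simp only [if_true, map_inv₀, Complex.conj_ofReal]
      field_simp
    · simp [h, Subtype.ext_iff.not.mp h]
  have hsq : ∀ s : P, (√(lam s) : ℝ) =
      ‖∑ k, inner ℂ (w s) (WithLp.toLp 2 (a k)) * inner ℂ (WithLp.toLp 2 (b k)) (v s)‖ := by
    intro s
    have h0 : √(lam s) ≠ 0 := (Real.sqrt_ne_zero (hlam _)).mpr s.2
    have h1 : ((√(lam s) : ℝ) : ℂ) ≠ 0 := by exact_mod_cast h0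
    have h2 : (lam s : ℂ) = (√(lam s) : ℝ) * (√(lam s) : ℝ) := by
      rw [← Complex.ofReal_mul, Real.mul_self_sqrt (hlam _)]
    have h3 : inner ℂ (w s) (Mv s) = ((√(lam s) : ℝ) : ℂ) := by
      simp only [w, inner_smul_left, hinner, if_true]
      rw [h2]; simp
      field_simp
    have h4 : inner ℂ (w s) (Mv s) =
        ∑ k, inner ℂ (w s) (WithLp.toLp 2 (a k)) * inner ℂ (WithLp.toLp 2 (b k)) (v s) := by
      rw [hMv, inner_sum]
      refine Finset.sum_congr rfl fun k _ => ?_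
      rw [inner_smul_right, mul_comm]
    rw [← h4, h3, Complex.norm_real, Real.norm_of_nonneg (Real.sqrt_nonneg _)]
  have hv' : Orthonormal ℂ (fun s : P => v s) := v.orthonormal.comp _ Subtype.val_injective
  calc traceNorm M = ∑ s, √(lam s) := rfl
    _ = ∑ s : P, √(lam s) := by
        rw [← Finset.sum_subtype (Finset.univ.filter fun s => lam s ≠ 0) (by simp)
          (fun s => √(lam s))]
        refine (Finset.sum_filter_of_ne (p := fun s => lam s ≠ 0) fun s _ hs h => hs ?_).symm
        rw [h, Real.sqrt_zero]
    _ ≤ ∑ s : P, ∑ k, ‖inner ℂ (w s) (WithLp.toLp 2 (a k))‖ *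
          ‖inner ℂ (v s) (WithLp.toLp 2 (b k))‖ := by
        refine Finset.sum_le_sum fun s _ => ?_
        rw [hsq s]
        refine (norm_sum_le _ _).trans_eq (Finset.sum_congr rfl fun k _ => ?_)
        rw [norm_mul, norm_inner_symm (v s)]
    _ = ∑ k, ∑ s : P, ‖inner ℂ (w s) (WithLp.toLp 2 (a k))‖ *
          ‖inner ℂ (v s) (WithLp.toLp 2 (b k))‖ := Finset.sum_comm
    _ ≤ ∑ k, vnorm (a k) * vnorm (b k) := by
        refine Finset.sum_le_sum fun k _ => ?_
        refine (Real.sum_mul_le_sqrt_mul_sqrt _ _ _).trans ?_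
        refine mul_le_mul ?_ ?_ (Real.sqrt_nonneg _) (vnorm_nonneg _)
        · exact Real.sqrt_le_iff.mpr ⟨vnorm_nonneg _, hw.sum_inner_products_le _⟩
        · exact Real.sqrt_le_iff.mpr ⟨vnorm_nonneg _, hv'.sum_inner_products_le _⟩

lemma sum_vnorm_sq_mulVec [DecidableEq S] (K : κ → Matrix T S ℂ) (hK : ∑ k, (K k)ᴴ * K k = 1)
    (v : S → ℂ) : ∑ k, vnorm (K k *ᵥ v) ^ 2 = vnorm v ^ 2 := by
  have h : ((∑ k, vnorm (K k *ᵥ v) ^ 2 : ℝ) : ℂ) = ((vnorm v ^ 2 : ℝ) : ℂ) := by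
    rw [Complex.ofReal_sum]
    simp_rw [← star_dotProduct_self, Matrix.star_mulVec, ← Matrix.dotProduct_mulVec,
      Matrix.mulVec_mulVec]
    rw [← dotProduct_sum, ← Matrix.sum_mulVec, hK, Matrix.one_mulVec]
  exact_mod_cast h

/-- If every Kraus operator of a channel sends the part `g` of a unit vector `g + b` to a multiple
of the unit vector `γ`, the output is close to `γ` as soon as `b` is small. -/
lemma traceNorm_krausMap_sub_proj_le [DecidableEq S] [DecidableEq T] (K : κ → Matrix T S ℂ)
    (hK : ∑ k, (K k)ᴴ * K k = 1) (g b : S → ℂ) (γ : T → ℂ) (hγ : vnorm γ = 1)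
    (hg : ∀ k, ∃ α : ℂ, K k *ᵥ g = α • γ) (hgb : vnorm g ^ 2 + vnorm b ^ 2 = 1)
    (hψ : vnorm (g + b) = 1) :
    traceNorm (krausMap K (proj (g + b)) - proj γ) ≤ 3 * vnorm b := by
  choose α hα using hg
  have hsum : ∑ k, ‖α k‖ ^ 2 = vnorm g ^ 2 := by
    rw [← sum_vnorm_sq_mulVec K hK g]
    refine Finset.sum_congr rfl fun k _ => ?_
    rw [hα, vnorm_smul, hγ, mul_one]
  -- Since `∑ ‖α k‖² = ‖g‖² = 1 - ‖b‖²`, the terms quadratic in `g` cancel `proj γ` up to `-‖b‖² •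
  -- proj γ`. The three groups contribute at most `‖b‖`, `‖g‖ ‖b‖` and `‖b‖²`.
  have key : krausMap K (proj (g + b)) - proj γ =
      ∑ i : κ ⊕ κ ⊕ Unit, Matrix.vecMulVec
        (Sum.elim (fun k => K k *ᵥ b) (Sum.elim (fun k => K k *ᵥ g)
          (fun _ => (-(vnorm b ^ 2 : ℝ) : ℂ) • γ)) i)
        (star (Sum.elim (fun k => K k *ᵥ (g + b)) (Sum.elim (fun k => K k *ᵥ b)
          (fun _ => γ)) i)) := by
    rw [Fintype.sum_sum_type, Fintype.sum_sum_type]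
    simp only [Sum.elim_inl, Sum.elim_inr, Finset.univ_unique, Finset.sum_singleton]
    have h1 : krausMap K (proj (g + b)) =
        ∑ k, (Matrix.vecMulVec (K k *ᵥ b) (star (K k *ᵥ (g + b))) +
          Matrix.vecMulVec (K k *ᵥ g) (star (K k *ᵥ b)) +
          Matrix.vecMulVec (K k *ᵥ g) (star (K k *ᵥ g))) := by
      change ∑ k, K k * proj (g + b) * (K k)ᴴ = _
      refine Finset.sum_congr rfl fun k _ => ?_
      rw [mul_proj_mul_conjTranspose, proj, Matrix.mulVec_add]
      simp only [star_add, Matrix.vecMulVec_add, Matrix.add_vecMulVec]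
      abel
    have h2 : ∑ k, Matrix.vecMulVec (K k *ᵥ g) (star (K k *ᵥ g)) =
        ((vnorm g ^ 2 : ℝ) : ℂ) • proj γ := by
      rw [← hsum, Complex.ofReal_sum, Finset.sum_smul]
      refine Finset.sum_congr rfl fun k _ => ?_
      rw [hα, proj, star_smul, Matrix.smul_vecMulVec, Matrix.vecMulVec_smul, smul_smul]
      congr 1
      simp [Complex.mul_conj']
    rw [h1, Finset.sum_add_distrib, Finset.sum_add_distrib, h2, Matrix.smul_vecMulVec, ← proj]
    have h3 : ((vnorm g ^ 2 : ℝ) : ℂ) = 1 - ((vnorm b ^ 2 : ℝ) : ℂ) := by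
      rw [eq_sub_iff_add_eq, ← Complex.ofReal_add, hgb, Complex.ofReal_one]
    rw [h3, sub_smul, neg_smul, one_smul]
    abel
  rw [key]
  refine (traceNorm_sum_vecMulVec_le _ _).trans ?_
  rw [Fintype.sum_sum_type, Fintype.sum_sum_type]
  simp only [Sum.elim_inl, Sum.elim_inr, Finset.univ_unique, Finset.sum_singleton]
  have cs : ∀ u v : S → ℂ, ∑ k, vnorm (K k *ᵥ u) * vnorm (K k *ᵥ v) ≤ vnorm u * vnorm v := by
    intro u v
    refine (Real.sum_mul_le_sqrt_mul_sqrt _ _ _).trans_eq ?_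
    rw [sum_vnorm_sq_mulVec K hK, sum_vnorm_sq_mulVec K hK, Real.sqrt_sq (vnorm_nonneg _),
      Real.sqrt_sq (vnorm_nonneg _)]
  have c1 := cs b (g + b)
  have c2 := cs g b
  have hg0 := vnorm_nonneg g
  have hb0 := vnorm_nonneg b
  have hg1 : vnorm g ≤ 1 := by nlinarith
  have hb1 : vnorm b ≤ 1 := by nlinarith
  have c3 : vnorm ((-(vnorm b ^ 2 : ℝ) : ℂ) • γ) * vnorm γ = vnorm b ^ 2 := by
    rw [vnorm_smul, hγ, norm_neg, Complex.norm_real, Real.norm_of_nonneg (by positivity)]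
    ring
  rw [c3]
  rw [hψ] at c1
  nlinarith

end TraceNorm

/-! ### Tensor products of local operators -/

section TensorOp

variable {m : ℕ} {A B C : Fin m → Type}

lemma tensorOp_conjTranspose (K : ∀ j, Matrix (B j) (A j) ℂ) :
    (tensorOp K)ᴴ = tensorOp fun j => (K j)ᴴ := by
  ext a b
  simp [tensorOp, Matrix.conjTranspose_apply]

lemma tensorOp_mul [∀ j, Fintype (B j)] (K : ∀ j, Matrix (C j) (B j) ℂ)
    (L : ∀ j, Matrix (B j) (A j) ℂ) :
    tensorOp K * tensorOp L = tensorOp fun j => K j * L j := by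
  ext c a
  simp only [tensorOp, Matrix.mul_apply, Matrix.of_apply, ← Finset.prod_mul_distrib]
  rw [Finset.prod_univ_sum, Fintype.piFinset_univ]

lemma sum_tensorOp {κ : Type} [Fintype κ] (K : ∀ j, κ → Matrix (B j) (A j) ℂ) :
    ∑ f : Fin m → κ, tensorOp (fun j => K j (f j)) = tensorOp fun j => ∑ k, K j k := by
  ext b a
  simp only [tensorOp, Matrix.sum_apply, Matrix.of_apply]
  rw [Finset.prod_univ_sum, Fintype.piFinset_univ]

lemma tensorOp_diagonal [∀ j, DecidableEq (A j)] (d : ∀ j, A j → ℂ) :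
    tensorOp (fun j => Matrix.diagonal (d j)) = Matrix.diagonal fun x => ∏ j, d j (x j) := by
  ext b a
  simp only [tensorOp, Matrix.of_apply, Matrix.diagonal_apply]
  by_cases h : b = a
  · subst h; simp
  · obtain ⟨j, hj⟩ := Function.ne_iff.mp h
    rw [if_neg h]
    exact Finset.prod_eq_zero (Finset.mem_univ j) (if_neg hj)

lemma tensorOp_one [∀ j, DecidableEq (A j)] :
    tensorOp (fun j => (1 : Matrix (A j) (A j) ℂ)) = 1 := by
  simp_rw [← Matrix.diagonal_one, tensorOp_diagonal]
  simp

/-- Completeness of the Kraus operators of one round. -/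
lemma sum_tensorOp_conjTranspose_mul_self [∀ j, Fintype (A j)] [∀ j, DecidableEq (A j)]
    [∀ j, Fintype (C j)] {U κ : Type} [Fintype U] [Fintype κ] (i : Fin m)
    (K : U → ∀ j, κ → Matrix (C j) (A j) ℂ)
    (instrument : ∑ u, ∑ k, (K u i k)ᴴ * K u i k = 1)
    (channel : ∀ u, ∀ j, j ≠ i → ∑ k, (K u j k)ᴴ * K u j k = 1) :
    ∑ u, ∑ f : Fin m → κ,
      (tensorOp fun j => K u j (f j))ᴴ * tensorOp (fun j => K u j (f j)) = 1 := by
  simp_rw [tensorOp_conjTranspose, tensorOp_mul]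
  simp_rw [fun u => sum_tensorOp (fun j k => (K u j k)ᴴ * K u j k)]
  rw [← tensorOp_one]
  ext b a
  -- For each `u` the factors of the parties other than `i` are already the identity, so the sum
  -- over `u` acts on factor `i` alone.
  have h : ∀ D : ∀ j, Matrix (A j) (A j) ℂ, (∀ j, j ≠ i → D j = 1) → tensorOp D b a =
      D i (b i) (a i) * ∏ j ∈ Finset.univ.erase i, (1 : Matrix (A j) (A j) ℂ) (b j) (a j) := by
    intro D hD
    rw [tensorOp, Matrix.of_apply, ← Finset.mul_prod_erase _ _ (Finset.mem_univ i)]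
    congr 1
    refine Finset.prod_congr rfl fun j hj => ?_
    rw [hD j (Finset.ne_of_mem_erase hj)]
  rw [Matrix.sum_apply, h _ fun _ _ => rfl]
  simp_rw [fun u => h _ (channel u)]
  rw [← Finset.sum_mul, ← Matrix.sum_apply, instrument]

end TensorOp

/-! ### Exact distillation of unnormalised vectors -/

section Distills

variable {m : ℕ} {A C : Fin m → Type} [∀ j, Fintype (A j)] [∀ j, DecidableEq (A j)]
  [∀ j, Fintype (C j)] [∀ j, DecidableEq (C j)] {k : ℕ}

/-- Some LOCC channel has Kraus operators which send every vector of `G` to a multiple of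
`k` copies of the GHZ vector. -/
def Distills (A : Fin m → Type) [∀ j, Fintype (A j)] [∀ j, DecidableEq (A j)] (k : ℕ)
    (G : Set ((∀ j, A j) → ℂ)) : Prop :=
  ∃ Λ, IsLOCC A (fun _ => Fin k → Fin 2) Λ ∧
    ∃ (κ : Type) (_ : Fintype κ) (K : κ → Matrix (Fin m → Fin k → Fin 2) (∀ j, A j) ℂ),
      Λ = krausMap K ∧ ∑ l, (K l)ᴴ * K l = 1 ∧
      ∀ g ∈ G, ∀ l, ∃ α : ℂ, K l *ᵥ g = α • tensorPower (ghz m) k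

lemma Distills.done (G : Set ((Fin m → Fin k → Fin 2) → ℂ))
    (hG : ∀ g ∈ G, ∃ α : ℂ, g = α • tensorPower (ghz m) k) :
    Distills (fun _ : Fin m => Fin k → Fin 2) k G := by
  refine ⟨LinearMap.id, IsLOCC.done _, Unit, inferInstance, fun _ => 1, ?_, by simp, ?_⟩
  · ext1 ρ
    simp [krausMap]
  · intro g hg _
    simpa using hG g hg

/-- The continuation knows `u` but not the Kraus indices `f`, so it has to succeed on all the
resulting vectors simultaneously. This is why `Distills` speaks of a set of vectors. -/
lemma Distills.round {U κ : Type} [Fintype U] [Fintype κ] (i : Fin m)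
    (K : U → ∀ j, κ → Matrix (C j) (A j) ℂ)
    (instrument : ∑ u, ∑ k, (K u i k)ᴴ * K u i k = 1)
    (channel : ∀ u, ∀ j, j ≠ i → ∑ k, (K u j k)ᴴ * K u j k = 1)
    (G : Set ((∀ j, A j) → ℂ))
    (next : ∀ u, Distills C k {h | ∃ g ∈ G, ∃ f : Fin m → κ,
      h = tensorOp (fun j => K u j (f j)) *ᵥ g}) :
    Distills A k G := by
  choose Λ hΛ τ hτ L hL hcomp hspan using next
  refine ⟨_, IsLOCC.round i K instrument channel Λ hΛ, (Σ u, τ u × (Fin m → κ)), inferInstance,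
    fun l => L l.1 l.2.1 * tensorOp (fun j => K l.1 j (l.2.2 j)), ?_, ?_, ?_⟩
  · refine LinearMap.ext fun ρ => ?_
    simp only [LinearMap.sum_apply, LinearMap.comp_apply]
    change _ = ∑ l : (Σ u, τ u × (Fin m → κ)), _
    rw [Fintype.sum_sigma]
    refine Finset.sum_congr rfl fun u _ => ?_
    rw [hL u, Fintype.sum_prod_type]
    refine Finset.sum_congr rfl fun l _ => ?_
    change L u l * (∑ f : Fin m → κ, tensorOp (fun j => K u j (f j)) * ρ *
      (tensorOp fun j => K u j (f j))ᴴ) * (L u l)ᴴ = _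
    rw [Matrix.mul_sum, Matrix.sum_mul]
    refine Finset.sum_congr rfl fun f _ => ?_
    simp only [Matrix.conjTranspose_mul, Matrix.mul_assoc]
  · rw [Fintype.sum_sigma, ← sum_tensorOp_conjTranspose_mul_self i K instrument channel]
    refine Finset.sum_congr rfl fun u _ => ?_
    rw [Fintype.sum_prod_type, Finset.sum_comm]
    refine Finset.sum_congr rfl fun f _ => ?_
    simp only [Matrix.conjTranspose_mul]
    calc _ = ∑ l, (tensorOp fun j => K u j (f j))ᴴ * ((L u l)ᴴ * L u l) *
          tensorOp (fun j => K u j (f j)) := by simp only [Matrix.mul_assoc]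
      _ = _ := by rw [← Matrix.sum_mul, ← Matrix.mul_sum, hcomp, Matrix.mul_one]
  · rintro g hg ⟨u, l, f⟩
    obtain ⟨α, hα⟩ := hspan u _ ⟨g, hg, f, rfl⟩ l
    exact ⟨α, by rw [← hα, Matrix.mulVec_mulVec]⟩

open scoped Classical in
/-- A nondestructive measurement of a function of the basis state of party `i`. -/
lemma Distills.measure {U : Type} (i : Fin m) (f : A i → U) (g : (∀ j, A j) → ℂ)
    (next : ∀ u, Distills A k {Set.indicator {x | f (x i) = u} g}) : Distills A k {g} := by
  -- Restricting the outcomes to the range of `f` keeps them finite when `U` is infinite. There is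
  -- one Kraus operator per outcome, so a single vector remains a single vector.
  let d : Set.range f → ∀ j, A j → ℂ := fun u =>
    Function.update (fun _ _ => 1) i fun a => if f a = u then 1 else 0
  have : Fintype (Set.range f) := Fintype.ofFinite _
  refine Distills.round (C := A) (U := Set.range f) (κ := Unit) i
    (fun u j _ => Matrix.diagonal (d u j)) ?_ ?_ _ ?_
  · simp only [Matrix.diagonal_conjTranspose, Matrix.diagonal_mul_diagonal, Finset.univ_unique,
      Finset.sum_singleton]
    ext a b
    rw [Matrix.sum_apply]
    simp only [Matrix.diagonal_apply, Matrix.one_apply]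
    by_cases hab : a = b
    · subst hab
      simp only [if_true, d, Function.update_self, Pi.star_apply]
      rw [Finset.sum_eq_single ⟨f a, a, rfl⟩]
      · simp
      · rintro ⟨u, hu⟩ _ hne
        have : f a ≠ u := fun h => hne (by simp [h])
        simp [this]
      · simp
    · simp [hab]
  · intro u j hj
    simp [d, hj]
  · intro u
    convert next u using 1
    ext h
    simp only [Set.mem_singleton_iff, exists_eq_left, Set.mem_ofPred_eq, tensorOp_diagonal]
    have : (Matrix.diagonal fun x : (∀ j, A j) => ∏ j, d u j (x j)) *ᵥ g =
        Set.indicator {x | f (x i) = u} g := by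
      ext x
      rw [Matrix.mulVec_diagonal, Finset.prod_eq_single i]
      · simp [d, Set.indicator_apply]
      · intro j _ hj
        simp [d, hj]
      · simp
    rw [this]
    simp

/-- Nondestructive measurements of a function of the basis state by each party. -/
lemma Distills.measure_all {U : Fin m → Type} [∀ j, Nonempty (U j)] (f : ∀ j, A j → U j)
    (g : (∀ j, A j) → ℂ)
    (next : ∀ c : ∀ j, U j, Distills A k {Set.indicator {x | ∀ j, f j (x j) = c j} g}) :
    Distills A k {g} := by
  have key : ∀ S : Finset (Fin m),
      (∀ c : ∀ j, U j, Distills A k {Set.indicator {x | ∀ j ∈ S, f j (x j) = c j} g}) →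
      Distills A k {g} := by
    intro S
    induction S using Finset.induction_on with
    | empty =>
      intro h
      have := h fun j => Classical.arbitrary _
      simpa using this
    | insert i S hi ih =>
      intro h
      refine ih fun c => Distills.measure i (f i) _ fun u => ?_
      convert h (Function.update c i u) using 2
      rw [Set.indicator_indicator]
      congr 1
      ext x
      have : (∀ j ∈ S, f j (x j) = Function.update c i u j) ↔ ∀ j ∈ S, f j (x j) = c j := by
        refine forall₂_congr fun j hj => ?_
        rw [Function.update_of_ne (ne_of_mem_of_not_mem hj hi)]
      simp [this]
  exact key Finset.univ (by simpa using next)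

end Distills

/-! ### Extracting GHZ vectors from correlated basis states -/

section Extract

variable {m : ℕ} {A : Fin m → Type} {k : ℕ}

/-- The local relabelling of party `j`: states with a label get it, the others are discarded. -/
def encode (e : ∀ j, A j → Option (Fin k → Fin 2)) (j : Fin m) (a : A j) :
    (Fin k → Fin 2) × Option (Σ j, A j) :=
  (e j a).elim (0, some ⟨j, a⟩) fun y => (y, none)

/-- A state without a label is stored whole in the second component, so the default string `0`
merges nothing. Injectivity makes the relabelling an isometry. -/
lemma encode_injective (e : ∀ j, A j → Option (Fin k → Fin 2))
    (he : ∀ j a a' y, e j a = some y → e j a' = some y → a = a') (j : Fin m) :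
    Function.Injective (encode e j) := by
  intro a a' h
  unfold encode at h
  rcases ha : e j a with _ | y <;> rcases ha' : e j a' with _ | y' <;>
    simp only [ha, ha', Option.elim_none, Option.elim_some, Prod.mk.injEq, reduceCtorEq,
      and_false, and_true] at h
  · simpa using h
  · subst h
    exact he j a a' y ha ha'

variable [∀ j, Fintype (A j)] [∀ j, DecidableEq (A j)]

-- A product of conditions "all parties hold the same bit" is "all parties hold the same string". A
-- party must exist for the all-zero and all-one basis states to be distinct.
open scoped Classical in
lemma tensorPower_ghz (hm : 0 < m) (k : ℕ) : tensorPower (ghz m) k =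
    (((√2 : ℝ) : ℂ) ^ k)⁻¹ • fun t : Fin m → Fin k → Fin 2 =>
      if ∃ y, ∀ j, t j = y then 1 else 0 := by
  ext t
  have hghz : ∀ x : Fin m → Fin 2, ghz m x =
      ((√2 : ℝ) : ℂ)⁻¹ * if ∃ y, ∀ j, x j = y then 1 else 0 := by
    intro x
    have h01 : (fun _ : Fin m => (0 : Fin 2)) ≠ fun _ => 1 := fun h => by
      simpa using congrFun h ⟨0, hm⟩
    have hiff : (∃ y, ∀ j, x j = y) ↔ (x = fun _ => 0) ∨ (x = fun _ => 1) := by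
      constructor
      · rintro ⟨y, hy⟩
        fin_cases y
        · exact Or.inl (funext hy)
        · exact Or.inr (funext hy)
      · rintro (h | h) <;> exact ⟨_, fun j => congrFun h j⟩
    simp only [hiff, ghz]
    by_cases h0 : x = fun _ => 0
    · subst h0
      simp [h01]
    · simp [h0, div_eq_mul_inv, mul_comm]
  have hiff : (∃ y, ∀ j, t j = y) ↔ ∀ s, ∃ y, ∀ j, t j s = y := by
    constructor
    · rintro ⟨y, hy⟩ s
      exact ⟨y s, fun j => by rw [hy j]⟩
    · intro h
      choose y hy using h
      exact ⟨y, fun j => funext fun s => hy s j⟩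
  simp only [tensorPower, hghz, Finset.prod_mul_distrib, Finset.prod_const, Finset.card_univ,
    Fintype.card_fin, Pi.smul_apply, smul_eq_mul, inv_pow, hiff]
  congr 1
  rw [Finset.prod_ite_zero]
  simp

lemma vnorm_tensorPower_eq_one {X : Fin m → Type} [∀ i, Fintype (X i)] [∀ i, DecidableEq (X i)]
    (ψ : (∀ i, X i) → ℂ) (hψ : ∑ x, ‖ψ x‖ ^ 2 = 1) (n : ℕ) : vnorm (tensorPower ψ n) = 1 := by
  rw [← sq_eq_sq₀ (vnorm_nonneg _) zero_le_one, vnorm_sq, one_pow]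
  rw [← Equiv.sum_comp (Equiv.piComm fun (_ : Fin n) (i : Fin m) => X i)]
  simp only [tensorPower, Equiv.piComm_apply, norm_prod, ← Finset.prod_pow]
  have := Finset.prod_univ_sum (fun _ : Fin n => (Finset.univ : Finset (∀ i, X i)))
    (fun _ x => ‖ψ x‖ ^ 2)
  rw [Fintype.piFinset_univ] at this
  simp only [Function.swap]
  rw [← this, hψ]
  simp

lemma sum_norm_ghz_sq (hm : 0 < m) : ∑ x, ‖ghz m x‖ ^ 2 = 1 := by
  have h01 : (fun _ : Fin m => (0 : Fin 2)) ≠ fun _ => 1 := fun h => by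
    simpa using congrFun h ⟨0, hm⟩
  have h : ∀ x : Fin m → Fin 2, ‖ghz m x‖ ^ 2 =
      (if x = fun _ => 0 then 1 / 2 else 0) + (if x = fun _ => 1 then 1 / 2 else 0) := by
    intro x
    by_cases h0 : x = fun _ => 0
    · subst h0
      simp [ghz, h01]
    · by_cases h1 : x = fun _ => 1
      · subst h1
        simp [ghz, h01.symm]
      · simp [ghz, h0, h1]
  simp_rw [h, Finset.sum_add_distrib]
  simp
  norm_num

/-- The Kraus operators of the local relabelling, preceded by a diagonal unitary. -/
def encodeKraus (e : ∀ j, A j → Option (Fin k → Fin 2)) (θ : ∀ j, A j → ℂ) (j : Fin m)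
    (c : Option (Σ j, A j)) : Matrix (Fin k → Fin 2) (A j) ℂ :=
  Matrix.of fun t a => if encode e j a = (t, c) then θ j a else 0

/-- The index `c` is the second register of the isometry `encode`, which is traced out; completeness
is injectivity together with unit phases. -/
lemma sum_encodeKraus (e : ∀ j, A j → Option (Fin k → Fin 2))
    (he : ∀ j a a' y, e j a = some y → e j a' = some y → a = a') (θ : ∀ j, A j → ℂ)
    (hθ : ∀ j a, ‖θ j a‖ = 1) (j : Fin m) :
    ∑ c, (encodeKraus e θ j c)ᴴ * encodeKraus e θ j c = 1 := by
  ext a a'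
  rw [Matrix.sum_apply]
  simp only [Matrix.mul_apply, Matrix.conjTranspose_apply, encodeKraus, Matrix.of_apply]
  rw [Finset.sum_comm, ← Fintype.sum_prod_type' (f := fun t c =>
    star (if encode e j a = (t, c) then θ j a else 0) *
      if encode e j a' = (t, c) then θ j a' else 0)]
  simp only [Prod.mk.eta]
  rw [Finset.sum_eq_single (encode e j a)]
  · by_cases h : a = a'
    · subst h
      simp [Complex.conj_mul', hθ]
    · have : encode e j a' ≠ encode e j a := fun h' => h (encode_injective e he j h').symm
      simp [h, this]
  · intro p _ hp
    simp [hp.symm]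
  · simp

/-- One round of local channels without communication. -/
lemma Distills.of_local (hm : 0 < m) {κ : Type} [Fintype κ]
    (K : ∀ j, κ → Matrix (Fin k → Fin 2) (A j) ℂ) (hK : ∀ j, ∑ c, (K j c)ᴴ * K j c = 1)
    (g : (∀ j, A j) → ℂ)
    (hg : ∀ f : Fin m → κ, ∃ α : ℂ, tensorOp (fun j => K j (f j)) *ᵥ g =
      α • tensorPower (ghz m) k) : Distills A k {g} := by
  refine Distills.round (U := Unit) ⟨0, hm⟩ (fun _ => K) (by simpa using hK _) (fun _ j _ => hK j)
    _ fun _ => Distills.done _ ?_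
  rintro _ ⟨_, rfl, f, rfl⟩
  exact hg f

lemma Distills.zero (hm : 0 < m) (k : ℕ) : Distills A k {0} := by
  refine Distills.of_local hm (encodeKraus (fun _ _ => none) fun _ _ => 1)
    (sum_encodeKraus _ (by simp) _ (by simp)) _ fun f => ⟨0, by simp⟩

/-- For `k = 0` the output space is one-dimensional, so every vector is a multiple of the target. -/
lemma Distills.zero_copies (hm : 0 < m) (g : (∀ j, A j) → ℂ) : Distills A 0 {g} := by
  refine Distills.of_local hm (encodeKraus (fun _ _ => none) fun _ _ => 1)
    (sum_encodeKraus _ (by simp) _ (by simp)) _ fun f => ?_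
  refine ⟨(tensorOp (fun j => encodeKraus (k := 0) (fun _ _ => none) (fun _ _ => 1) j (f j)) *ᵥ g)
    default, ?_⟩
  ext t
  rw [Subsingleton.elim t default]
  simp [tensorPower]

/-- A phase that makes a complex number nonnegative. -/
def phase (z : ℂ) : ℂ := if z = 0 then 1 else star z / ‖z‖

lemma norm_phase (z : ℂ) : ‖phase z‖ = 1 := by
  unfold phase
  split_ifs with h
  · simp
  · simp [h]

lemma phase_mul (z : ℂ) : phase z * z = ‖z‖ := by
  unfold phase
  split_ifs with h
  · simp [h]
  · have : (‖z‖ : ℂ) ≠ 0 := by simpa using h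
    rw [div_mul_eq_mul_div, div_eq_iff this]
    simp [Complex.conj_mul', sq]

/-- A vector of constant modulus on `2 ^ k` basis states that each party can tell apart. -/
lemma Distills.of_block (hm : 0 < m) (g : (∀ j, A j) → ℂ) (G : Finset (∀ j, A j))
    (hcard : G.card = 2 ^ k) (hinj : ∀ x ∈ G, ∀ x' ∈ G, ∀ j, x j = x' j → x = x')
    (hsupp : ∀ x, x ∉ G → g x = 0) (r : ℝ) (hr : ∀ x ∈ G, ‖g x‖ = r) : Distills A k {g} := by
  classical
  have hc : Fintype.card (Fin k → Fin 2) = Fintype.card G := by simp [hcard]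
  let E : (Fin k → Fin 2) ≃ G := Fintype.equivOfCardEq hc
  have hE : ∀ y y' j, (E y).1 j = (E y').1 j → y = y' := fun y y' j h =>
    E.injective (Subtype.ext (hinj _ (E y).2 _ (E y').2 j h))
  let e : ∀ j, A j → Option (Fin k → Fin 2) := fun j a =>
    if h : ∃ y, (E y).1 j = a then some h.choose else none
  have heE : ∀ j y, e j ((E y).1 j) = some y := by
    intro j y
    have h : ∃ y', (E y').1 j = (E y).1 j := ⟨y, rfl⟩
    simp only [e, dif_pos h, Option.some.injEq]
    exact hE _ _ j h.choose_spec
  have he : ∀ j a a' y, e j a = some y → e j a' = some y → a = a' := by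
    intro j a a' y h h'
    simp only [e] at h h'
    split_ifs at h h' with h1 h2
    rw [← h1.choose_spec, ← h2.choose_spec, Option.some.inj h, Option.some.inj h']
  let i₀ : Fin m := ⟨0, hm⟩
  -- The state of a single party determines the string within the block, so that party can cancel
  -- all the phases.
  let θ : ∀ j, A j → ℂ := fun j a =>
    if j = i₀ then (e j a).elim 1 (fun y => phase (g (E y).1)) else 1
  have hθ : ∀ j a, ‖θ j a‖ = 1 := by
    intro j a
    simp only [θ]
    split_ifs
    · rcases e j a with _ | y <;> simp [norm_phase]
    · simp
  have hprod : ∀ y, (∏ j, θ j ((E y).1 j)) * g (E y).1 = r := by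
    intro y
    rw [Finset.prod_eq_single i₀]
    · simp only [θ, if_true, heE, Option.elim_some, phase_mul, hr _ (E y).2]
    · intro j _ hj
      simp [θ, hj]
    · simp
  refine Distills.of_local hm (encodeKraus e θ) (sum_encodeKraus e he θ hθ) g fun f => ?_
  have hval : ∀ t, (tensorOp (fun j => encodeKraus e θ j (f j)) *ᵥ g) t =
      ∑ y, if ∀ j, t j = y ∧ f j = none then (r : ℂ) else 0 := by
    intro t
    simp only [Matrix.mulVec, dotProduct]
    rw [← Finset.sum_subset (Finset.subset_univ G)
      fun x _ hx => by rw [hsupp x hx, mul_zero], ← Finset.sum_coe_sort G, ← Equiv.sum_comp E]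
    refine Finset.sum_congr rfl fun y _ => ?_
    have hrel : ∀ j, encode e j ((E y).1 j) = (y, none) := fun j => by simp [encode, heE]
    simp only [tensorOp, encodeKraus, Matrix.of_apply, hrel, Prod.mk.injEq]
    rw [Finset.prod_ite_zero]
    have : (∀ j ∈ (Finset.univ : Finset (Fin m)), y = t j ∧ none = f j) ↔
        ∀ j, t j = y ∧ f j = none := by
      simp [eq_comm]
    simp only [this]
    split_ifs
    · exact hprod y
    · simp
  by_cases hf : ∀ j, f j = none
  -- The factor `√2 ^ k` undoes the normalisation of the GHZ vectors. If some discarded register is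
  -- not `none`, the output is zero, because every string in `G` carries labels.
  · refine ⟨r * ((√2 : ℝ) : ℂ) ^ k, ?_⟩
    rw [tensorPower_ghz hm, smul_smul, mul_assoc, mul_inv_cancel₀ (by simp), mul_one]
    ext t
    rw [hval]
    simp only [hf, and_true, Pi.smul_apply, smul_eq_mul]
    by_cases ht : ∃ y, ∀ j, t j = y
    · rw [if_pos ht]
      obtain ⟨y, hy⟩ := ht
      rw [Finset.sum_eq_single y]
      · simp [hy]
      · intro y' _ hne
        rw [if_neg]
        exact fun h => hne ((h i₀).symm.trans (hy i₀))
      · simp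
    · rw [if_neg ht, mul_zero]
      refine Finset.sum_eq_zero fun y _ => if_neg fun h => ht ⟨y, h⟩
  · refine ⟨0, ?_⟩
    ext t
    rw [hval, zero_smul]
    refine Finset.sum_eq_zero fun y _ => if_neg fun h => hf fun j => (h j).2

/-- A vector supported on a union of blocks of `2 ^ k` basis states. -/
lemma Distills.of_blocks (hm : 0 < m) {L : Type} [DecidableEq L] (lab : (∀ j, A j) → L) (g : (∀ j, A j) → ℂ)
    (G : Finset (∀ j, A j)) (hinj : ∀ x ∈ G, ∀ x' ∈ G, ∀ j, x j = x' j → x = x')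
    (hsupp : ∀ x, x ∉ G → g x = 0)
    (hcard : ∀ x ∈ G, (G.filter fun x' => lab x' = lab x).card = 2 ^ k)
    (hconst : ∀ x ∈ G, ∀ x' ∈ G, lab x = lab x' → ‖g x‖ = ‖g x'‖) : Distills A k {g} := by
  classical
  let i₀ : Fin m := ⟨0, hm⟩
  -- On `G` one coordinate determines the whole string, so the global label is a function of what
  -- party `i₀` holds; `none` marks states that do not occur in `G`.
  let F : A i₀ → Option L := fun a =>
    if h : ∃ x ∈ G, x i₀ = a then some (lab h.choose) else none
  have hF : ∀ x ∈ G, F (x i₀) = some (lab x) := by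
    intro x hx
    have h : ∃ x' ∈ G, x' i₀ = x i₀ := ⟨x, hx, rfl⟩
    simp only [F, dif_pos h]
    rw [hinj _ h.choose_spec.1 x hx i₀ h.choose_spec.2]
  refine Distills.measure i₀ F g fun u => ?_
  by_cases hu : ∃ x ∈ G, some (lab x) = u
  · obtain ⟨x, hx, rfl⟩ := hu
    refine Distills.of_block hm _ (G.filter fun x' => lab x' = lab x) (hcard x hx) ?_ ?_ ‖g x‖ ?_
    · intro y hy z hz
      exact hinj y (Finset.mem_filter.mp hy).1 z (Finset.mem_filter.mp hz).1
    · intro y hy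
      by_cases hyG : y ∈ G
      · refine Set.indicator_of_notMem (fun h => hy ?_) _
        refine Finset.mem_filter.mpr ⟨hyG, ?_⟩
        have h' : F (y i₀) = some (lab x) := h
        rw [hF y hyG] at h'
        exact Option.some.inj h'
      · exact Set.indicator_apply_eq_zero.mpr fun _ => hsupp y hyG
    · intro y hy
      obtain ⟨hyG, hyl⟩ := Finset.mem_filter.mp hy
      rw [Set.indicator_of_mem]
      · exact hconst y hyG x hx hyl
      · change F (y i₀) = _
        rw [hF y hyG, hyl]
  · have : Set.indicator {x : ∀ j, A j | F (x i₀) = u} g = 0 := by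
      ext x
      refine Set.indicator_apply_eq_zero.mpr fun hxu => hsupp x fun hx => hu ⟨x, hx, ?_⟩
      rw [← hF x hx]
      exact hxu
    rw [this]
    exact Distills.zero hm k

/-- A vector supported on a set whose parts with given values of local functions are unions of
blocks of `2 ^ k` basis states. -/
lemma Distills.of_hashed_blocks (hm : 0 < m) {U : Fin m → Type} [∀ j, Nonempty (U j)]
    [∀ j, DecidableEq (U j)]
    (f : ∀ j, A j → U j) {L : Type} [DecidableEq L] (lab : (∀ j, A j) → L) (g : (∀ j, A j) → ℂ)
    (G : Finset (∀ j, A j))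
    (hinj : ∀ x ∈ G, ∀ x' ∈ G, (∀ j, f j (x j) = f j (x' j)) → ∀ j, x j = x' j → x = x')
    (hsupp : ∀ x, x ∉ G → g x = 0)
    (hcard : ∀ x ∈ G, (G.filter fun x' => (∀ j, f j (x' j) = f j (x j)) ∧
      lab x' = lab x).card = 2 ^ k)
    (hconst : ∀ x ∈ G, ∀ x' ∈ G, lab x = lab x' → ‖g x‖ = ‖g x'‖) : Distills A k {g} := by
  refine Distills.measure_all f g fun c => ?_
  refine Distills.of_blocks hm lab _ (G.filter fun x => ∀ j, f j (x j) = c j) ?_ ?_ ?_ ?_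
  · intro x hx x' hx'
    obtain ⟨hx, hxc⟩ := Finset.mem_filter.mp hx
    obtain ⟨hx', hxc'⟩ := Finset.mem_filter.mp hx'
    exact hinj x hx x' hx' fun j => (hxc j).trans (hxc' j).symm
  · intro x hx
    refine Set.indicator_apply_eq_zero.mpr fun hxc => hsupp x fun hxG => hx ?_
    exact Finset.mem_filter.mpr ⟨hxG, hxc⟩
  · intro x hx
    obtain ⟨hx, hxc⟩ := Finset.mem_filter.mp hx
    rw [← hcard x hx, Finset.filter_filter]
    simp only [hxc]
  · intro x hx x' hx' h
    obtain ⟨hx, hxc⟩ := Finset.mem_filter.mp hx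
    obtain ⟨hx', hxc'⟩ := Finset.mem_filter.mp hx'
    rw [Set.indicator_of_mem (by exact hxc), Set.indicator_of_mem (by exact hxc')]
    exact hconst x hx x' hx' h

/-- Exact distillation of a restriction of `ψ^{⊗ n}` that carries most of the weight gives an
accurate protocol. -/
lemma isAccurate_of_distills (hm : 0 < m) {X : Fin m → Type} [∀ i, Fintype (X i)]
    [∀ i, DecidableEq (X i)] (ψ : (∀ i, X i) → ℂ) (hψ : ∑ x, ‖ψ x‖ ^ 2 = 1) (n k : ℕ)
    (G : Finset (∀ i, Fin n → X i)) (ε : ℝ) (hε : 0 ≤ ε)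
    (hG : ∑ x ∈ Gᶜ, ‖tensorPower ψ n x‖ ^ 2 ≤ (ε / 2) ^ 2)
    (h : Distills (fun i => Fin n → X i) k {Set.indicator (G : Set _) (tensorPower ψ n)}) :
    IsAccurate ψ n k ε := by
  obtain ⟨Λ, hΛ, κ, _, K, rfl, hK, hspan⟩ := h
  refine ⟨_, hΛ, ?_⟩
  set v := tensorPower ψ n
  set g := Set.indicator (G : Set _) v with hgdef
  set b := Set.indicator (G : Set _)ᶜ v with hbdef
  have hgb : g + b = v := Set.indicator_self_add_compl _ _
  have hv : vnorm v = 1 := vnorm_tensorPower_eq_one ψ hψ n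
  have hb : vnorm b ^ 2 = ∑ x ∈ Gᶜ, ‖v x‖ ^ 2 := by
    rw [vnorm_sq, ← Finset.sum_subset (Finset.subset_univ Gᶜ)]
    · refine Finset.sum_congr rfl fun x hx => ?_
      rw [hbdef, Set.indicator_of_mem (by simpa using hx)]
    · intro x _ hx
      rw [hbdef, Set.indicator_of_notMem (by simpa using hx)]
      simp
  have hg : vnorm g ^ 2 = ∑ x ∈ G, ‖v x‖ ^ 2 := by
    rw [vnorm_sq, ← Finset.sum_subset (Finset.subset_univ G)]
    · refine Finset.sum_congr rfl fun x hx => ?_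
      rw [hgdef, Set.indicator_of_mem (by simpa using hx)]
    · intro x _ hx
      rw [hgdef, Set.indicator_of_notMem (by simpa using hx)]
      simp
  have hsum : vnorm g ^ 2 + vnorm b ^ 2 = 1 := by
    rw [hg, hb, Finset.sum_add_sum_compl, ← vnorm_sq, hv, one_pow]
  have hbε : vnorm b ≤ ε / 2 := by
    rw [← hb] at hG
    exact (sq_le_sq₀ (vnorm_nonneg _) (by positivity)).mp hG
  have key := traceNorm_krausMap_sub_proj_le K hK g b (tensorPower (ghz m) k)
    (vnorm_tensorPower_eq_one _ (sum_norm_ghz_sq hm) k) (hspan g rfl) hsum (by rw [hgb, hv])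
  rw [hgb] at key
  -- The error is at most `1/2 * 3 * (ε / 2) ≤ ε`.
  linarith

end Extract

/-! ### Weak law of large numbers for finite alphabets -/

section Chebyshev

variable {S : Type} [Fintype S]

lemma sum_prod_eq_one {p : S → ℝ} (hp1 : ∑ s, p s = 1) (n : ℕ) :
    ∑ x : Fin n → S, ∏ t, p (x t) = 1 := by
  have := Finset.prod_univ_sum (fun _ : Fin n => (Finset.univ : Finset S)) (fun _ s => p s)
  rw [Fintype.piFinset_univ] at this
  rw [← this, hp1]
  simp

lemma sum_fin_succ (n : ℕ) (F : (Fin (n + 1) → S) → ℝ) :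
    ∑ x, F x = ∑ s, ∑ y : Fin n → S, F (Fin.cons s y) := by
  rw [← Fintype.sum_prod_type', ← Equiv.sum_comp (Fin.consEquiv fun _ => S)]
  rfl

lemma sum_prod_mul_sum {p W : S → ℝ} (hp1 : ∑ s, p s = 1) (hW : ∑ s, p s * W s = 0) (n : ℕ) :
    ∑ x : Fin n → S, (∏ t, p (x t)) * ∑ t, W (x t) = 0 := by
  induction n with
  | zero => simp
  | succ n ih =>
    rw [sum_fin_succ]
    simp only [Fin.prod_univ_succ, Fin.sum_univ_succ, Fin.cons_zero, Fin.cons_succ]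
    have h : ∀ s, ∑ y : Fin n → S, p s * (∏ t, p (y t)) * (W s + ∑ t, W (y t)) =
        p s * W s := by
      intro s
      calc _ = p s * W s * ∑ y : Fin n → S, ∏ t, p (y t) +
            p s * ∑ y : Fin n → S, (∏ t, p (y t)) * ∑ t, W (y t) := by
            rw [Finset.mul_sum, Finset.mul_sum, ← Finset.sum_add_distrib]
            exact Finset.sum_congr rfl fun y _ => by ring
        _ = _ := by rw [ih, sum_prod_eq_one hp1]; ring
    simp_rw [h, hW]

/-- Variances of independent centred variables add: on splitting off one letter, the cross term
vanishes by `sum_prod_mul_sum`. -/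
lemma sum_prod_mul_sum_sq {p W : S → ℝ} (hp1 : ∑ s, p s = 1) (hW : ∑ s, p s * W s = 0) (n : ℕ) :
    ∑ x : Fin n → S, (∏ t, p (x t)) * (∑ t, W (x t)) ^ 2 = n * ∑ s, p s * W s ^ 2 := by
  induction n with
  | zero => simp
  | succ n ih =>
    rw [sum_fin_succ]
    simp only [Fin.prod_univ_succ, Fin.sum_univ_succ, Fin.cons_zero, Fin.cons_succ]
    have h : ∀ s, ∑ y : Fin n → S, p s * (∏ t, p (y t)) * (W s + ∑ t, W (y t)) ^ 2 =
        p s * W s ^ 2 + p s * (n * ∑ s, p s * W s ^ 2) := by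
      intro s
      calc _ = p s * W s ^ 2 * ∑ y : Fin n → S, ∏ t, p (y t) +
            2 * p s * W s * ∑ y : Fin n → S, (∏ t, p (y t)) * ∑ t, W (y t) +
            p s * ∑ y : Fin n → S, (∏ t, p (y t)) * (∑ t, W (y t)) ^ 2 := by
            rw [Finset.mul_sum, Finset.mul_sum, Finset.mul_sum, ← Finset.sum_add_distrib,
              ← Finset.sum_add_distrib]
            exact Finset.sum_congr rfl fun y _ => by ring
        _ = _ := by rw [ih, sum_prod_eq_one hp1, sum_prod_mul_sum hp1 hW]; ring
    simp_rw [h, Finset.sum_add_distrib, ← Finset.sum_mul, hp1]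
    push_cast
    ring

/-- Chebyshev's inequality for the sum of `n` independent copies of `Z`. -/
lemma sum_prod_deviation_le {p : S → ℝ} (hp0 : ∀ s, 0 ≤ p s) (hp1 : ∑ s, p s = 1) (Z : S → ℝ)
    (μ : ℝ) (hμ : ∑ s, p s * Z s = μ) {ε : ℝ} (hε : 0 < ε) {n : ℕ} (hn : 0 < n) :
    ∑ x : Fin n → S with n * ε < |∑ t, Z (x t) - n * μ|, ∏ t, p (x t) ≤
      (∑ s, p s * (Z s - μ) ^ 2) / ε ^ 2 / n := by
  have hn' : (0 : ℝ) < n := by exact_mod_cast hn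
  have hW : ∑ s, p s * (Z s - μ) = 0 := by
    simp_rw [mul_sub, Finset.sum_sub_distrib, ← Finset.sum_mul, hμ, hp1]
    ring
  have key := sum_prod_mul_sum_sq hp1 hW n
  have hprod : ∀ x : Fin n → S, 0 ≤ ∏ t, p (x t) := fun x => Finset.prod_nonneg fun t _ => hp0 _
  have h : (∑ x : Fin n → S with n * ε < |∑ t, Z (x t) - n * μ|, ∏ t, p (x t)) * (n * ε) ^ 2 ≤
      n * ∑ s, p s * (Z s - μ) ^ 2 := by
    rw [← key, Finset.sum_mul]
    refine (Finset.sum_le_sum fun x hx => ?_).trans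
      (Finset.sum_le_sum_of_subset_of_nonneg (Finset.filter_subset _ _)
        fun x _ _ => mul_nonneg (hprod x) (sq_nonneg _))
    refine mul_le_mul_of_nonneg_left ?_ (hprod x)
    have hx := (Finset.mem_filter.mp hx).2
    have : ∑ t, (Z (x t) - μ) = ∑ t, Z (x t) - n * μ := by simp
    rw [this, ← sq_abs (∑ t, Z (x t) - n * μ)]
    exact pow_le_pow_left₀ (by positivity) hx.le 2
  rw [div_div, le_div_iff₀ (by positivity)]
  have h2 : n * ((∑ x : Fin n → S with n * ε < |∑ t, Z (x t) - n * μ|, ∏ t, p (x t)) *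
      (ε ^ 2 * n)) ≤ n * ∑ s, p s * (Z s - μ) ^ 2 := by
    calc _ = (∑ x : Fin n → S with n * ε < |∑ t, Z (x t) - n * μ|, ∏ t, p (x t)) *
          (n * ε) ^ 2 := by ring
      _ ≤ _ := h
  exact le_of_mul_le_mul_left h2 hn'

end Chebyshev

/-! ### Marginals and typical sequences -/

section Typical

variable {m : ℕ} {X : Fin m → Type} {p : (∀ i, X i) → ℝ}

/-- The product distribution on sequences, as seen by the parties. -/
def seqDist (p : (∀ i, X i) → ℝ) (n : ℕ) (x : ∀ i, Fin n → X i) : ℝ :=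
  ∏ t, p fun i => x i t

lemma seqDist_nonneg (hp0 : ∀ x, 0 ≤ p x) {n : ℕ} (x : ∀ i, Fin n → X i) : 0 ≤ seqDist p n x :=
  Finset.prod_nonneg fun _ _ => hp0 _

lemma sum_swap [∀ i, Fintype (X i)] {n : ℕ} (F : (∀ i, Fin n → X i) → ℝ) :
    ∑ x, F x = ∑ y : Fin n → ∀ i, X i, F fun i t => y t i :=
  (Equiv.sum_comp (Equiv.piComm fun (_ : Fin n) (i : Fin m) => X i) F).symm

lemma sum_seqDist [∀ i, Fintype (X i)] (hp1 : ∑ x, p x = 1) (n : ℕ) : ∑ x, seqDist p n x = 1 := by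
  rw [sum_swap]
  exact sum_prod_eq_one hp1 n

variable [∀ i, Fintype (X i)] [∀ i, DecidableEq (X i)]

/-- The probability of the marginal `x_J` of a basis state `x`. -/
def marginalAt (p : (∀ i, X i) → ℝ) (J : Finset (Fin m)) (x : ∀ i, X i) : ℝ :=
  marginal p J fun i => x i

lemma marginalAt_univ (p : (∀ i, X i) → ℝ) (x : ∀ i, X i) : marginalAt p Finset.univ x = p x := by
  rw [marginalAt, marginal, Finset.sum_eq_single x]
  · intro y hy hne
    refine absurd (funext fun i => ?_) hne
    exact congrFun (Finset.mem_filter.mp hy).2 ⟨i, Finset.mem_univ i⟩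
  · simp

lemma le_marginalAt (hp0 : ∀ x, 0 ≤ p x) (J : Finset (Fin m)) (x : ∀ i, X i) :
    p x ≤ marginalAt p J x :=
  Finset.single_le_sum (f := p) (fun y _ => hp0 y) (by simp)

/-- Summing over fibres expresses every marginal entropy as an expectation under the full
distribution, so the law of large numbers applies to all `J` on one sample space. -/
lemma entropy_marginal (p : (∀ i, X i) → ℝ) (J : Finset (Fin m)) :
    entropy (marginal p J) = ∑ x, p x * -Real.logb 2 (marginalAt p J x) := by
  rw [entropy, ← Finset.sum_neg_distrib]
  rw [← Finset.sum_fiberwise Finset.univ (fun x : (∀ i, X i) => fun i : J => x i)]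
  refine Finset.sum_congr rfl fun y _ => ?_
  rw [← mul_neg]
  nth_rewrite 1 [marginal]
  rw [Finset.sum_mul]
  refine Finset.sum_congr rfl fun x hx => ?_
  rw [marginalAt, (Finset.mem_filter.mp hx).2]

lemma entropy_marginal_univ (p : (∀ i, X i) → ℝ) :
    entropy (marginal p Finset.univ) = entropy p := by
  rw [entropy_marginal, entropy, ← Finset.sum_neg_distrib]
  simp [marginalAt_univ]

lemma condEntropy_compl (p : (∀ i, X i) → ℝ) (I : Finset (Fin m)) :
    condEntropy p I Iᶜ = entropy p - entropy (marginal p Iᶜ) := by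
  rw [condEntropy, Finset.union_compl, entropy_marginal_univ]

lemma condEntropy_compl_nonneg (hp0 : ∀ x, 0 ≤ p x) (I : Finset (Fin m)) :
    0 ≤ condEntropy p I Iᶜ := by
  rw [condEntropy, Finset.union_compl, entropy_marginal, entropy_marginal,
    ← Finset.sum_sub_distrib]
  refine Finset.sum_nonneg fun x _ => ?_
  rcases (hp0 x).eq_or_lt with h | h
  · simp [← h]
  · rw [← mul_sub]
    refine mul_nonneg h.le ?_
    rw [sub_nonneg, neg_le_neg_iff, marginalAt_univ]
    exact Real.logb_le_logb_of_le one_lt_two h (le_marginalAt hp0 _ x)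

/-- The sequences all of whose marginals are weakly typical. -/
def typicalSet (p : (∀ i, X i) → ℝ) (n : ℕ) (ε : ℝ) : Finset (∀ i, Fin n → X i) :=
  Finset.univ.filter fun x => (∀ t, p (fun i => x i t) ≠ 0) ∧
    ∀ J, |∑ t, -Real.logb 2 (marginalAt p J fun i => x i t) - n * entropy (marginal p J)| ≤ n * ε

lemma eventually_sum_typicalSet_compl_le (hp0 : ∀ x, 0 ≤ p x) (hp1 : ∑ x, p x = 1) {ε η : ℝ}
    (hε : 0 < ε) (hη : 0 < η) :
    ∀ᶠ n : ℕ in Filter.atTop, ∑ x ∈ (typicalSet p n ε)ᶜ, seqDist p n x ≤ η := by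
  let V : Finset (Fin m) → ℝ := fun J =>
    (∑ x, p x * (-Real.logb 2 (marginalAt p J x) - entropy (marginal p J)) ^ 2) / ε ^ 2
  have hbound : ∀ n : ℕ, 0 < n → ∑ x ∈ (typicalSet p n ε)ᶜ, seqDist p n x ≤ (∑ J, V J) / n := by
    intro n hn
    let D : Finset (Fin m) → Finset (∀ i, Fin n → X i) := fun J => Finset.univ.filter fun x =>
      n * ε < |∑ t, -Real.logb 2 (marginalAt p J fun i => x i t) - n * entropy (marginal p J)|
    have hD : ∀ J, ∑ x ∈ D J, seqDist p n x ≤ V J / n := by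
      intro J
      have := sum_prod_deviation_le hp0 hp1 (fun x => -Real.logb 2 (marginalAt p J x))
        (entropy (marginal p J)) (entropy_marginal p J).symm hε hn
      refine le_trans (le_of_eq ?_) this
      rw [Finset.sum_filter, sum_swap, Finset.sum_filter]
      rfl
    calc ∑ x ∈ (typicalSet p n ε)ᶜ, seqDist p n x
        ≤ ∑ x, ∑ J, if x ∈ D J then seqDist p n x else 0 := by
          have hnn : ∀ x : ∀ i, Fin n → X i, ∀ J, 0 ≤ if x ∈ D J then seqDist p n x else 0 := by
            intro x J
            split_ifs
            exacts [seqDist_nonneg hp0 x, le_rfl]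
          refine (Finset.sum_le_sum fun x hx => ?_).trans (Finset.sum_le_sum_of_subset_of_nonneg
            (Finset.subset_univ _) fun x _ _ => Finset.sum_nonneg fun J _ => hnn x J)
          -- A sequence excluded only because some letter has probability zero carries no weight.
          by_cases hx0 : seqDist p n x = 0
          · rw [hx0]
            simp
          rw [Finset.mem_compl, typicalSet, Finset.mem_filter] at hx
          have h0 : ∀ t, p (fun i => x i t) ≠ 0 := fun t =>
            Finset.prod_ne_zero_iff.mp hx0 t (Finset.mem_univ t)
          simp only [Finset.mem_univ, true_and, h0, ne_eq, not_false_eq_true, implies_true,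
            not_forall, not_le] at hx
          obtain ⟨J, hJ⟩ := hx
          have hxJ : x ∈ D J := by simpa [D] using hJ
          refine le_trans (le_of_eq ?_) (Finset.single_le_sum (fun J _ => hnn x J)
            (Finset.mem_univ J))
          rw [if_pos hxJ]
      _ = ∑ J, ∑ x ∈ D J, seqDist p n x := by
          rw [Finset.sum_comm]
          refine Finset.sum_congr rfl fun J _ => ?_
          rw [Finset.sum_ite_mem, Finset.univ_inter]
      _ ≤ ∑ J, V J / n := Finset.sum_le_sum fun J _ => hD J
      _ = _ := by rw [Finset.sum_div]
  have hlim : Filter.Tendsto (fun n : ℕ => (∑ J, V J) / n) Filter.atTop (nhds 0) :=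
    tendsto_const_div_atTop_nhds_zero_nat _
  filter_upwards [hlim.eventually (ge_mem_nhds hη), Filter.eventually_gt_atTop 0] with n h1 h2
  exact (hbound n h2).trans h1

/-- Typicality includes `p ≠ 0` at every time, so all the marginals are positive and the product is
genuinely `2` to the sum of the logarithms (whose default value at `0` would spoil this). -/
lemma prod_marginalAt_of_typical (hp0 : ∀ x, 0 ≤ p x) {n : ℕ} {ε : ℝ} {x : ∀ i, Fin n → X i}
    (hx : x ∈ typicalSet p n ε) (J : Finset (Fin m)) :
    (2 : ℝ) ^ (-(n * (entropy (marginal p J) + ε))) ≤ ∏ t, marginalAt p J (fun i => x i t) ∧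
      ∏ t, marginalAt p J (fun i => x i t) ≤
        (2 : ℝ) ^ (-(n * (entropy (marginal p J) - ε))) := by
  obtain ⟨h0, hJ⟩ := (Finset.mem_filter.mp hx).2
  have hpos : ∀ t, 0 < marginalAt p J (fun i => x i t) := fun t =>
    ((hp0 _).lt_of_ne (h0 t).symm).trans_le (le_marginalAt hp0 J _)
  have hprod : ∏ t, marginalAt p J (fun i => x i t) =
      (2 : ℝ) ^ (∑ t, Real.logb 2 (marginalAt p J fun i => x i t)) := by
    rw [Real.rpow_sum_of_pos two_pos]
    refine Finset.prod_congr rfl fun t _ => ?_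
    rw [Real.rpow_logb two_pos (by norm_num) (hpos t)]
  have h := abs_le.mp (hJ J)
  rw [Finset.sum_neg_distrib] at h
  rw [hprod]
  constructor <;> refine Real.rpow_le_rpow_of_exponent_le one_le_two ?_ <;>
    linarith [h.1, h.2]

lemma seqDist_bounds_of_typical (hp0 : ∀ x, 0 ≤ p x) {n : ℕ} {ε : ℝ} {x : ∀ i, Fin n → X i}
    (hx : x ∈ typicalSet p n ε) :
    (2 : ℝ) ^ (-(n * (entropy p + ε))) ≤ seqDist p n x ∧
      seqDist p n x ≤ (2 : ℝ) ^ (-(n * (entropy p - ε))) := by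
  have := prod_marginalAt_of_typical hp0 hx Finset.univ
  simpa only [marginalAt_univ, entropy_marginal_univ, seqDist] using this

/-- Agreement on `J` is a separate condition at each time, so the total weight factorises. -/
lemma sum_seqDist_agree (n : ℕ) (J : Finset (Fin m)) (x : ∀ i, Fin n → X i) :
    ∑ x' with (∀ i ∈ J, x' i = x i), seqDist p n x' = ∏ t, marginalAt p J (fun i => x i t) := by
  simp only [marginalAt, marginal]
  rw [Finset.prod_univ_sum, Finset.sum_filter, sum_swap, ← Finset.sum_filter]
  refine Finset.sum_congr ?_ fun y _ => rfl
  ext y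
  simp only [Finset.mem_filter, Finset.mem_univ, true_and, Fintype.mem_piFinset, funext_iff,
    Subtype.forall]
  exact ⟨fun h t i hi => h i hi t, fun h i hi t => h t i hi⟩

/-- The number of typical sequences that agree with a given one outside `I`. -/
lemma card_typical_agree_le (hp0 : ∀ x, 0 ≤ p x) {n : ℕ} {ε : ℝ} {x : ∀ i, Fin n → X i}
    (hx : x ∈ typicalSet p n ε) (I : Finset (Fin m)) :
    (((typicalSet p n ε).filter fun x' => ∀ i ∈ Iᶜ, x' i = x i).card : ℝ) ≤
      (2 : ℝ) ^ (n * (condEntropy p I Iᶜ + 2 * ε)) := by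
  -- Each counted sequence weighs at least `2 ^ (-n (H + ε))`, while together they weigh at most the
  -- probability of the common part outside `I`.
  have h1 : (((typicalSet p n ε).filter fun x' => ∀ i ∈ Iᶜ, x' i = x i).card : ℝ) *
      (2 : ℝ) ^ (-(n * (entropy p + ε))) ≤ (2 : ℝ) ^ (-(n * (entropy (marginal p Iᶜ) - ε))) := by
    refine le_trans ?_ (prod_marginalAt_of_typical hp0 hx Iᶜ).2
    rw [← sum_seqDist_agree, ← nsmul_eq_mul]
    refine (Finset.card_nsmul_le_sum _ (seqDist p n) _ fun x' hx' =>
      (seqDist_bounds_of_typical hp0 (Finset.mem_filter.mp hx').1).1).trans ?_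
    exact Finset.sum_le_sum_of_subset_of_nonneg
      (Finset.filter_subset_filter _ (Finset.subset_univ _)) fun x _ _ => seqDist_nonneg hp0 x
  rw [← le_div_iff₀ (by positivity), ← Real.rpow_sub two_pos] at h1
  refine h1.trans_eq ?_
  rw [condEntropy_compl]
  congr 1
  ring

end Typical

/-! ### Random hashing -/

section Hashing

/-- A colliding `h` and a free value `u` encode an arbitrary function: overwrite `h a` by `u`. The
value lost is recovered from `h b`. -/
lemma card_collision_mul {α : Type} [Fintype α] [DecidableEq α] {M : ℕ} {a b : α} (hab : a ≠ b) :
    (Finset.univ.filter fun h : α → Fin M => h a = h b).card * M =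
      Fintype.card (α → Fin M) := by
  have h : (Finset.univ.filter fun h : α → Fin M => h a = h b).card * M =
      ((Finset.univ.filter fun h : α → Fin M => h a = h b) ×ˢ
        (Finset.univ : Finset (Fin M))).card := by
    simp [Finset.card_product]
  rw [h, ← Finset.card_univ]
  refine Finset.card_bij' (fun q _ => Function.update q.1 a q.2)
    (fun h _ => (Function.update h a (h b), h a)) ?_ ?_ ?_ ?_
  · simp
  · simp [Function.update_of_ne hab.symm]
  · rintro ⟨h, u⟩ hh
    have hh : h a = h b := by simpa using hh
    simp [Function.update_of_ne hab.symm, ← hh]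
  · simp

variable {m : ℕ} {A : Fin m → Type} [∀ j, Fintype (A j)] [∀ j, DecidableEq (A j)]

/-- The hash functions are chosen independently, and only parties whose entries differ contribute a
factor `1 / M j` to the collision probability. -/
lemma card_hash_collision_mul (M : Fin m → ℕ) (x x' : ∀ j, A j) :
    (Finset.univ.filter fun f : ∀ j, A j → Fin (M j) => ∀ j, f j (x' j) = f j (x j)).card *
      ∏ j with x' j ≠ x j, M j = Fintype.card (∀ j, A j → Fin (M j)) := by
  have h : (Finset.univ.filter fun f : ∀ j, A j → Fin (M j) => ∀ j, f j (x' j) = f j (x j)) =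
      Fintype.piFinset fun j => Finset.univ.filter fun h : A j → Fin (M j) => h (x' j) = h (x j) := by
    ext f
    simp
  rw [h, Fintype.card_piFinset, Fintype.card_pi, Finset.prod_filter, ← Finset.prod_mul_distrib]
  refine Finset.prod_congr rfl fun j _ => ?_
  split_ifs with hj
  · exact card_collision_mul hj
  · push Not at hj
    simp [hj]

/-- `x` collides under the hash functions `f` with another element of `T` that some party cannot
tell from `x`. -/
def Collides {M : Fin m → ℕ} (T : Finset (∀ j, A j)) (f : ∀ j, A j → Fin (M j))
    (x : ∀ j, A j) : Prop :=
  ∃ x' ∈ T, x' ≠ x ∧ (∀ j, f j (x' j) = f j (x j)) ∧ ∃ j, x' j = x j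

-- First-moment argument. Sort the competitors `x'` by the set `I` where they differ from `x`: it is
-- nonempty since `x' ≠ x`, and proper since some party sees no difference. For each `I` there are
-- at most `β * ∏ M i` competitors, each colliding with probability `1 / ∏ M i`; the union bound
-- over at most `2 ^ m` sets makes the average colliding weight at most `2 ^ m * β`, and some `f`
-- does no worse than average.
open scoped Classical in
lemma exists_hash (M : Fin m → ℕ) (hM : ∀ j, 0 < M j) (T : Finset (∀ j, A j))
    (w : (∀ j, A j) → ℝ) (hw : ∀ x, 0 ≤ w x) (hw1 : ∑ x, w x = 1) (β : ℝ) (hβ : 0 ≤ β)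
    (hT : ∀ x ∈ T, ∀ I : Finset (Fin m), I.Nonempty → I ⊂ Finset.univ →
      ((T.filter fun x' => ∀ i ∈ Iᶜ, x' i = x i).card : ℝ) ≤ β * ∏ i ∈ I, (M i : ℝ)) :
    ∃ f : ∀ j, A j → Fin (M j), ∑ x ∈ T with Collides T f x, w x ≤ 2 ^ m * β := by
  have : ∀ j, NeZero (M j) := fun j => ⟨(hM j).ne'⟩
  let F := ∀ j, A j → Fin (M j)
  have hsingle : ∀ x ∈ T, ((Finset.univ.filter fun f : F => Collides T f x).card : ℝ) ≤
      Fintype.card F * (2 ^ m * β) := by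
    intro x hx
    let Q : Finset (Fin m) → Finset (∀ j, A j) := fun I =>
      T.filter fun x' => (Finset.univ.filter fun j => x' j ≠ x j) = I
    let PI : Finset (Finset (Fin m)) :=
      Finset.univ.filter fun I => I.Nonempty ∧ I ⊂ Finset.univ
    let coll : (∀ j, A j) → Finset F := fun x' =>
      Finset.univ.filter fun f => ∀ j, f j (x' j) = f j (x j)
    have hsub : (Finset.univ.filter fun f : F => Collides T f x) ⊆
        PI.biUnion fun I => (Q I).biUnion coll := by
      intro f hf
      obtain ⟨x', hx'T, hne, hcol, j, hj⟩ := (Finset.mem_filter.mp hf).2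
      refine Finset.mem_biUnion.mpr ⟨Finset.univ.filter fun j => x' j ≠ x j, ?_, ?_⟩
      · refine Finset.mem_filter.mpr ⟨Finset.mem_univ _, ?_, ?_⟩
        · obtain ⟨i, hi⟩ := Function.ne_iff.mp hne
          exact ⟨i, by simpa using hi⟩
        · rw [Finset.ssubset_univ_iff]
          intro h
          have := Finset.mem_univ j
          rw [← h] at this
          exact (Finset.mem_filter.mp this).2 hj
      · exact Finset.mem_biUnion.mpr ⟨x', by simp [Q, hx'T], by simpa [coll] using hcol⟩
    have hI : ∀ I ∈ PI, (∑ x' ∈ Q I, ((coll x').card : ℝ)) ≤ Fintype.card F * β := by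
      intro I hI
      obtain ⟨-, hne, hss⟩ := Finset.mem_filter.mp hI
      have hP : (0 : ℝ) < ∏ i ∈ I, (M i : ℝ) :=
        Finset.prod_pos fun i _ => by exact_mod_cast hM i
      have hc : ∀ x' ∈ Q I, ((coll x').card : ℝ) = Fintype.card F / ∏ i ∈ I, (M i : ℝ) := by
        intro x' hx'
        have h := card_hash_collision_mul M x x'
        rw [(Finset.mem_filter.mp hx').2] at h
        rw [eq_div_iff hP.ne']
        exact_mod_cast h
      rw [Finset.sum_congr rfl hc, Finset.sum_const, nsmul_eq_mul]
      have hQ : ((Q I).card : ℝ) ≤ β * ∏ i ∈ I, (M i : ℝ) := by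
        refine le_trans ?_ (hT x hx I hne hss)
        refine Nat.cast_le.mpr (Finset.card_le_card ?_)
        intro x' hx'
        obtain ⟨h1, h2⟩ := Finset.mem_filter.mp hx'
        refine Finset.mem_filter.mpr ⟨h1, fun i hi => ?_⟩
        rw [← h2] at hi
        simpa using hi
      calc ((Q I).card : ℝ) * (Fintype.card F / ∏ i ∈ I, (M i : ℝ))
          ≤ (β * ∏ i ∈ I, (M i : ℝ)) * (Fintype.card F / ∏ i ∈ I, (M i : ℝ)) := by gcongr
        _ = _ := by field_simp
    calc ((Finset.univ.filter fun f : F => Collides T f x).card : ℝ)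
        ≤ ((PI.biUnion fun I => (Q I).biUnion coll).card : ℝ) :=
          Nat.cast_le.mpr (Finset.card_le_card hsub)
      _ ≤ ∑ I ∈ PI, ∑ x' ∈ Q I, ((coll x').card : ℝ) := by
          exact_mod_cast Finset.card_biUnion_le.trans
            (Finset.sum_le_sum fun I _ => Finset.card_biUnion_le)
      _ ≤ ∑ I ∈ PI, Fintype.card F * β := Finset.sum_le_sum hI
      _ = PI.card * (Fintype.card F * β) := by rw [Finset.sum_const, nsmul_eq_mul]
      _ ≤ 2 ^ m * (Fintype.card F * β) := by
          have : PI.card ≤ 2 ^ m := (Finset.card_le_univ _).trans (by simp)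
          have : (PI.card : ℝ) ≤ 2 ^ m := by exact_mod_cast this
          gcongr
      _ = _ := by ring
  have htotal : ∑ f : F, ∑ x ∈ T with Collides T f x, w x ≤ ∑ _f : F, (2 ^ m * β) := by
    calc ∑ f : F, ∑ x ∈ T with Collides T f x, w x
        = ∑ x ∈ T, w x * ((Finset.univ.filter fun f : F => Collides T f x).card : ℝ) := by
          simp_rw [Finset.sum_filter]
          rw [Finset.sum_comm]
          refine Finset.sum_congr rfl fun x _ => ?_
          rw [← Finset.sum_filter, Finset.sum_const, nsmul_eq_mul, mul_comm]
      _ ≤ ∑ x ∈ T, w x * (Fintype.card F * (2 ^ m * β)) :=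
          Finset.sum_le_sum fun x hx => mul_le_mul_of_nonneg_left (hsingle x hx) (hw x)
      _ ≤ ∑ x, w x * (Fintype.card F * (2 ^ m * β)) :=
          Finset.sum_le_sum_of_subset_of_nonneg (Finset.subset_univ T)
            fun x _ _ => mul_nonneg (hw x) (by positivity)
      _ = _ := by
          rw [← Finset.sum_mul, hw1, one_mul, Finset.sum_const, nsmul_eq_mul, Finset.card_univ]
  obtain ⟨f, -, hf⟩ := Finset.exists_le_of_sum_le Finset.univ_nonempty htotal
  exact ⟨f, hf⟩

end Hashing

/-! ### Splitting cells into blocks of equal size -/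

section Blocks

variable {α V : Type} [DecidableEq α]

/-- Remove subsets of size `q` as long as possible; fewer than `q` elements remain. -/
lemma exists_blocks_of_finset (q : ℕ) (hq : 0 < q) (C : Finset α) :
    ∃ C' ⊆ C, ∃ lab : α → ℕ, (C \ C').card ≤ q ∧
      ∀ x ∈ C', (C'.filter fun x' => lab x' = lab x).card = q := by
  induction hn : C.card using Nat.strong_induction_on generalizing C with
  | _ n ih =>
    subst hn
    rcases lt_or_ge C.card q with h | h
    · exact ⟨∅, Finset.empty_subset _, fun _ => 0, by simpa using h.le, by simp⟩
    · obtain ⟨D, hDC, hD⟩ := Finset.exists_subset_card_eq h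
      have hlt : (C \ D).card < C.card := by
        rw [Finset.card_sdiff_of_subset hDC]
        omega
      obtain ⟨C', hC', lab, hleft, hlab⟩ := ih _ hlt (C \ D) rfl
      have hdisj : ∀ x ∈ C', x ∉ D := fun x hx => (Finset.mem_sdiff.mp (hC' hx)).2
      refine ⟨D ∪ C', Finset.union_subset hDC (hC'.trans Finset.sdiff_subset),
        -- Old labels move up by one to leave `0` for the new block.
        fun x => if x ∈ D then 0 else lab x + 1, ?_, ?_⟩
      · rwa [sdiff_sdiff_left] at hleft
      · intro x hx
        by_cases hxD : x ∈ D
        · rw [← hD]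
          congr 1
          ext y
          simp only [Finset.mem_filter, Finset.mem_union, hxD, if_true]
          constructor
          · rintro ⟨-, h⟩
            by_contra hy
            simp [hy] at h
          · intro hy
            simp [hy]
        · have hxC : x ∈ C' := (Finset.mem_union.mp hx).resolve_left hxD
          rw [← hlab x hxC]
          congr 1
          ext y
          simp only [Finset.mem_filter, Finset.mem_union, hxD, if_false]
          constructor
          · rintro ⟨h1, h2⟩
            by_cases hy : y ∈ D
            · simp [hy] at h2
            · simp only [hy, if_false, Nat.add_right_cancel_iff] at h2
              exact ⟨h1.resolve_left hy, h2⟩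
          · rintro ⟨h1, h2⟩
            simp [h1, hdisj y h1, h2]

/-- At most one incomplete block is lost per cell, so the loss depends on the number of cells and
not on the size of `C`. Putting the cell into the label keeps the blocks of different cells apart.
-/
lemma exists_blocks [Fintype V] [DecidableEq V] (q : ℕ) (hq : 0 < q) (C : Finset α)
    (cell : α → V) :
    ∃ G ⊆ C, ∃ lab : α → V × ℕ, (C \ G).card ≤ Fintype.card V * q ∧
      (∀ x, (lab x).1 = cell x) ∧
      ∀ x ∈ G, (G.filter fun x' => lab x' = lab x).card = q := by
  choose D hD lab hleft hlab using fun v =>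
    exists_blocks_of_finset q hq (C.filter fun x => cell x = v)
  have hDv : ∀ v, ∀ x ∈ D v, cell x = v := fun v x hx => (Finset.mem_filter.mp (hD v hx)).2
  refine ⟨C.filter fun x => x ∈ D (cell x), Finset.filter_subset _ _,
    fun x => (cell x, lab (cell x) x), ?_, fun _ => rfl, ?_⟩
  · have hsub : C \ (C.filter fun x => x ∈ D (cell x)) ⊆
        Finset.univ.biUnion fun v => (C.filter fun x => cell x = v) \ D v := by
      intro x hx
      simp only [Finset.mem_sdiff, Finset.mem_filter, not_and] at hx
      simp only [Finset.mem_biUnion, Finset.mem_univ, true_and, Finset.mem_sdiff,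
        Finset.mem_filter]
      exact ⟨cell x, ⟨hx.1, rfl⟩, hx.2 hx.1⟩
    refine (Finset.card_le_card hsub).trans (Finset.card_biUnion_le.trans ?_)
    refine (Finset.sum_le_sum fun v _ => hleft v).trans ?_
    simp
  · intro x hx
    obtain ⟨hxC, hxD⟩ := Finset.mem_filter.mp hx
    rw [← hlab (cell x) x hxD]
    congr 1
    ext y
    simp only [Finset.mem_filter, Prod.mk.injEq]
    constructor
    · rintro ⟨⟨h1, h2⟩, h3, h4⟩
      rw [h3] at h2 h4
      exact ⟨h2, h4⟩
    · rintro ⟨h1, h2⟩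
      have h3 := hDv _ y h1
      rw [h3]
      exact ⟨⟨(Finset.mem_filter.mp (hD _ h1)).1, h1⟩, rfl, h2⟩

end Blocks

/-! ### The minimal sum rate -/

section RateRegion

variable {m : ℕ} {X : Fin m → Type} [∀ i, Fintype (X i)] [∀ i, DecidableEq (X i)]
  {p : (∀ i, X i) → ℝ}

/-- For `m ≥ 2` singletons are proper subsets, so each rate dominates a nonnegative conditional
entropy. -/
lemma rate_nonneg (hm : 2 ≤ m) (hp0 : ∀ x, 0 ≤ p x) {R : Fin m → ℝ} (hR : R ∈ rateRegion p)
    (j : Fin m) : 0 ≤ R j := by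
  have hj : ({j} : Finset (Fin m)) ⊂ Finset.univ := by
    rw [Finset.ssubset_univ_iff]
    intro h
    have := congrArg Finset.card h
    simp at this
    omega
  have := hR {j} hj
  rw [Finset.sum_singleton] at this
  exact (condEntropy_compl_nonneg hp0 _).trans this

lemma rateRegion_nonempty (p : (∀ i, X i) → ℝ) : (rateRegion p).Nonempty := by
  -- Every single rate already exceeds all the bounds; for `I = ∅` both sides are zero.
  refine ⟨fun _ => ∑ I, |condEntropy p I Iᶜ|, fun I _ => ?_⟩
  rcases I.eq_empty_or_nonempty with rfl | hI
  · rw [condEntropy, Finset.empty_union]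
    simp
  · obtain ⟨i, hi⟩ := hI
    have h0 : 0 ≤ ∑ I : Finset (Fin m), |condEntropy p I Iᶜ| :=
      Finset.sum_nonneg fun _ _ => abs_nonneg _
    calc condEntropy p I Iᶜ ≤ |condEntropy p I Iᶜ| := le_abs_self _
      _ ≤ ∑ I : Finset (Fin m), |condEntropy p I Iᶜ| :=
          Finset.single_le_sum (f := fun I => |condEntropy p I Iᶜ|)
            (fun _ _ => abs_nonneg _) (Finset.mem_univ I)
      _ ≤ _ := Finset.single_le_sum (f := fun _ : Fin m => ∑ I, |condEntropy p I Iᶜ|)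
            (fun _ _ => h0) hi

lemma isClosed_rateRegion (p : (∀ i, X i) → ℝ) : IsClosed (rateRegion p) := by
  have : rateRegion p = ⋂ (I : Finset (Fin m)) (_ : I ⊂ Finset.univ),
      {R : Fin m → ℝ | condEntropy p I Iᶜ ≤ ∑ j ∈ I, R j} := by
    ext R
    simp [rateRegion]
  rw [this]
  exact isClosed_iInter fun I => isClosed_iInter fun _ =>
    isClosed_le continuous_const (by fun_prop)

/-- Nonnegative rates with bounded sum lie in a box, so each sublevel set of the sum rate in the
closed region is compact. -/
lemma isLeast_omniscienceRate (hm : 2 ≤ m) (hp0 : ∀ x, 0 ≤ p x) :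
    IsLeast (sumRates p) (omniscienceRate p) := by
  obtain ⟨R₀, hR₀⟩ := rateRegion_nonempty p
  let c := ∑ j, R₀ j
  have hcont : Continuous fun R : Fin m → ℝ => ∑ j, R j := by fun_prop
  have hclosed : IsClosed (rateRegion p ∩ {R | ∑ j, R j ≤ c}) :=
    (isClosed_rateRegion p).inter (isClosed_le hcont continuous_const)
  have hcompact : IsCompact (rateRegion p ∩ {R | ∑ j, R j ≤ c}) := by
    refine IsCompact.of_isClosed_subset (isCompact_Icc (a := fun _ => (0 : ℝ)) (b := fun _ => c))
      hclosed fun R hR => ⟨fun j => rate_nonneg hm hp0 hR.1 j, fun j => ?_⟩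
    exact (Finset.single_le_sum (fun i _ => rate_nonneg hm hp0 hR.1 i) (Finset.mem_univ j)).trans
      hR.2
  obtain ⟨R, hR, hmin⟩ := hcompact.exists_isMinOn ⟨R₀, hR₀, le_refl c⟩ hcont.continuousOn
  have hleast : IsLeast (sumRates p) (∑ j, R j) := by
    refine ⟨⟨R, hR.1, rfl⟩, ?_⟩
    rintro _ ⟨R', hR', rfl⟩
    rcases le_total (∑ j, R' j) c with h | h
    · exact hmin ⟨hR', h⟩
    · exact le_trans hR.2 h
  rw [omniscienceRate, hleast.csInf_eq]
  exact hleast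

end RateRegion

/-! ### Achievability -/

section Achievability

variable {m : ℕ} {X : Fin m → Type}

lemma norm_tensorPower_sq (ψ : (∀ i, X i) → ℂ) (n : ℕ) (x : ∀ i, Fin n → X i) :
    ‖tensorPower ψ n x‖ ^ 2 = seqDist (basisDist ψ) n x := by
  simp [tensorPower, seqDist, basisDist, norm_prod, Finset.prod_pow]

variable [∀ i, Fintype (X i)] [∀ i, DecidableEq (X i)]

/-- The numbers of occurrences of the letters in a sequence. -/
def letterCount {n : ℕ} (x : ∀ i, Fin n → X i) (s : ∀ i, X i) : Fin (n + 1) :=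
  ⟨(Finset.univ.filter fun t => (fun i => x i t) = s).card,
    Nat.lt_succ_of_le ((Finset.card_le_univ _).trans_eq (Fintype.card_fin n))⟩

/-- This is why the cells record letter counts: strings in one cell have amplitudes of equal
modulus, at the price of only a polynomial factor in the number of cells. -/
lemma seqDist_eq_prod_pow (p : (∀ i, X i) → ℝ) {n : ℕ} (x : ∀ i, Fin n → X i) :
    seqDist p n x = ∏ s, p s ^ (letterCount x s : ℕ) := by
  rw [seqDist, ← Finset.prod_fiberwise' Finset.univ (fun t i => x i t) p]
  refine Finset.prod_congr rfl fun s _ => ?_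
  rw [Finset.prod_const]
  rfl

/-- The number of hash values of each party. -/
def hashSize (R : Fin m → ℝ) (δ : ℝ) (n : ℕ) (j : Fin m) : ℕ :=
  ⌈(2 : ℝ) ^ (n * (R j + δ))⌉₊

lemma hashSize_bounds {R : Fin m → ℝ} (hR : ∀ j, 0 ≤ R j) {δ : ℝ} (hδ : 0 ≤ δ) (n : ℕ)
    (j : Fin m) : (2 : ℝ) ^ (n * (R j + δ)) ≤ hashSize R δ n j ∧
      (hashSize R δ n j : ℝ) ≤ 2 * (2 : ℝ) ^ (n * (R j + δ)) := by
  refine ⟨Nat.le_ceil _, ?_⟩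
  have h1 : (1 : ℝ) ≤ (2 : ℝ) ^ (n * (R j + δ)) :=
    Real.one_le_rpow one_le_two (mul_nonneg (Nat.cast_nonneg n) (add_nonneg (hR j) hδ))
  have := (Nat.ceil_lt_add_one (zero_le_one.trans h1)).le
  unfold hashSize
  linarith

/-- There are at most `2 ^ (n (H(X_I | X_Iᶜ) + δ/2))` typical competitors, while the hash values of
the parties in `I` number at least `2 ^ (n (H(X_I | X_Iᶜ) + δ))`, since `I` has at least one
element. The ratio gives `β = 2 ^ (-nδ/2)` in `exists_hash`; `G` consists of the typical strings
without collisions. -/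
lemma exists_good_hash (hm : 2 ≤ m) {p : (∀ i, X i) → ℝ} (hp0 : ∀ x, 0 ≤ p x)
    (hp1 : ∑ x, p x = 1) {R : Fin m → ℝ} (hR : R ∈ rateRegion p) {δ : ℝ} (hδ : 0 < δ) (n : ℕ) :
    ∃ f : ∀ j, (Fin n → X j) → Fin (hashSize R δ n j), ∃ G ⊆ typicalSet p n (δ / 4),
      (∀ x ∈ G, ∀ x' ∈ G, (∀ j, f j (x j) = f j (x' j)) → ∀ j, x j = x' j → x = x') ∧
      ∑ x ∈ typicalSet p n (δ / 4) \ G, seqDist p n x ≤ 2 ^ m * (2 : ℝ) ^ (-(n * (δ / 2))) := by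
  classical
  have hbd := hashSize_bounds (rate_nonneg hm hp0 hR) hδ.le n
  have hT : ∀ x ∈ typicalSet p n (δ / 4), ∀ I : Finset (Fin m), I.Nonempty → I ⊂ Finset.univ →
      (((typicalSet p n (δ / 4)).filter fun x' => ∀ i ∈ Iᶜ, x' i = x i).card : ℝ) ≤
        (2 : ℝ) ^ (-(n * (δ / 2))) * ∏ i ∈ I, (hashSize R δ n i : ℝ) := by
    intro x hx I hne hI
    refine (card_typical_agree_le hp0 hx I).trans ?_
    have hprod : (2 : ℝ) ^ (n * (condEntropy p I Iᶜ + δ)) ≤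
        ∏ i ∈ I, (hashSize R δ n i : ℝ) := by
      refine le_trans ?_ (Finset.prod_le_prod (fun i _ => by positivity) fun i _ => (hbd i).1)
      rw [← Real.rpow_sum_of_pos two_pos]
      refine Real.rpow_le_rpow_of_exponent_le one_le_two ?_
      rw [← Finset.mul_sum, Finset.sum_add_distrib, Finset.sum_const, nsmul_eq_mul]
      have h1 : (1 : ℝ) ≤ I.card := by exact_mod_cast hne.card_pos
      have h2 := hR I hI
      refine mul_le_mul_of_nonneg_left ?_ (Nat.cast_nonneg n)
      nlinarith
    refine le_trans (le_of_eq ?_) (mul_le_mul_of_nonneg_left hprod (by positivity))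
    rw [← Real.rpow_add two_pos]
    congr 1
    ring
  obtain ⟨f, hf⟩ := exists_hash (hashSize R δ n)
    (fun j => Nat.ceil_pos.mpr (by positivity)) (typicalSet p n (δ / 4)) (seqDist p n)
    (seqDist_nonneg hp0) (sum_seqDist hp1 n) ((2 : ℝ) ^ (-(n * (δ / 2)))) (by positivity) hT
  refine ⟨f, (typicalSet p n (δ / 4)).filter fun x => ¬ Collides (typicalSet p n (δ / 4)) f x,
    Finset.filter_subset _ _, ?_, ?_⟩
  · intro x hx x' hx' hfx j hj
    by_contra hne
    exact (Finset.mem_filter.mp hx').2 ⟨x, (Finset.mem_filter.mp hx).1, hne, hfx, j, hj⟩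
  · refine le_trans (le_of_eq ?_) hf
    refine Finset.sum_congr ?_ fun _ _ => rfl
    ext x
    simp only [Finset.mem_sdiff, Finset.mem_filter, not_and, not_not]
    tauto

/-- The number of cells, given by the hash values and the letter counts. -/
lemma card_cells_le {R : Fin m → ℝ} (hR : ∀ j, 0 ≤ R j) {δ : ℝ} (hδ : 0 ≤ δ) (n : ℕ) :
    (Fintype.card ((∀ j, Fin (hashSize R δ n j)) × ((∀ i, X i) → Fin (n + 1))) : ℝ) ≤
      2 ^ m * (2 : ℝ) ^ (n * (∑ j, R j + m * δ)) * (n + 1) ^ Fintype.card (∀ i, X i) := by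
  rw [Fintype.card_prod, Fintype.card_pi, Fintype.card_fun, Fintype.card_fin]
  simp only [Fintype.card_fin]
  push_cast
  refine mul_le_mul_of_nonneg_right ?_ (by positivity)
  refine (Finset.prod_le_prod (fun j _ => by positivity)
    fun j _ => (hashSize_bounds hR hδ n j).2).trans_eq ?_
  rw [Finset.prod_mul_distrib, Finset.prod_const, Finset.card_univ, Fintype.card_fin,
    ← Real.rpow_sum_of_pos two_pos, ← Finset.mul_sum, Finset.sum_add_distrib, Finset.sum_const,
    Finset.card_univ, Fintype.card_fin, nsmul_eq_mul]

lemma tendsto_const_mul_pow_mul_rpow (c : ℝ) (s : ℕ) {δ : ℝ} (hδ : 0 < δ) :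
    Filter.Tendsto (fun n : ℕ => c * ((n : ℝ) + 1) ^ s * (2 : ℝ) ^ (-(n * δ))) Filter.atTop
      (nhds 0) := by
  have hr0 : (0 : ℝ) < (2 : ℝ) ^ (-δ) := by positivity
  have hr1 : (2 : ℝ) ^ (-δ) < 1 := Real.rpow_lt_one_of_one_lt_of_neg one_lt_two (by linarith)
  have h := tendsto_pow_const_mul_const_pow_of_abs_lt_one s
    (show |(2 : ℝ) ^ (-δ)| < 1 by rwa [abs_of_pos hr0])
  -- The limit is shifted to `n + 1`; dividing `c` by `2 ^ (-δ)` compensates for the extra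
  -- exponential factor.
  have h' := ((Filter.tendsto_add_atTop_iff_nat 1).mpr h).const_mul (c / (2 : ℝ) ^ (-δ))
  rw [mul_zero] at h'
  refine h'.congr fun n => ?_
  have : (2 : ℝ) ^ (-(n * δ)) = ((2 : ℝ) ^ (-δ)) ^ n := by
    rw [← Real.rpow_natCast, ← Real.rpow_mul two_pos.le]
    congr 1
    ring
  rw [this, pow_succ]
  push_cast
  field_simp

/-- The permitted lost weight `η = (ε / 2) ^ 2` is shared equally by atypical strings, colliding
strings and strings in incomplete blocks. -/
lemma eventually_isAccurate (hm : 2 ≤ m) (ψ : (∀ i, X i) → ℂ) (hψ : ∑ x, ‖ψ x‖ ^ 2 = 1)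
    {R : Fin m → ℝ} (hR : R ∈ rateRegion (basisDist ψ)) {ε : ℝ} (hε : 0 < ε)
    (hpos : 0 < entropy (basisDist ψ) - ∑ j, R j - ε) :
    ∀ᶠ n : ℕ in Filter.atTop,
      IsAccurate ψ n ⌈n * (entropy (basisDist ψ) - ∑ j, R j - ε)⌉₊ ε := by
  set p := basisDist ψ with hp
  have hp0 : ∀ x, 0 ≤ p x := fun x => sq_nonneg _
  have hp1 : ∑ x, p x = 1 := hψ
  have hm' : (0 : ℝ) < m := by exact_mod_cast (by omega : 0 < m)
  -- The hashing overhead `m * δ` and the typicality slack `δ / 4` then fit into `ε / 2`, leaving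
  -- the decay `2 ^ (-n * ε / 2)`.
  set δ : ℝ := ε / (2 * (m + 1)) with hδdef
  have hδ : 0 < δ := by positivity
  have hδε : (m + 1) * δ = ε / 2 := by rw [hδdef]; field_simp
  set η : ℝ := (ε / 2) ^ 2 with hη
  have hη0 : 0 < η := by positivity
  have hbad := tendsto_const_mul_pow_mul_rpow (2 ^ m) 0 (half_pos hδ)
  -- Rounding up the `m` hash sizes costs `2 ^ m`, and rounding up `k` one more factor `2`.
  have hdrop := tendsto_const_mul_pow_mul_rpow (2 ^ (m + 1)) (Fintype.card (∀ i, X i))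
    (half_pos hε)
  filter_upwards [eventually_sum_typicalSet_compl_le hp0 hp1 (ε := δ / 4) (by positivity)
    (show 0 < η / 3 by positivity), hbad.eventually (ge_mem_nhds (show 0 < η / 3 by positivity)),
    hdrop.eventually (ge_mem_nhds (show 0 < η / 3 by positivity))] with n htyp hbad hdrop
  set k := ⌈n * (entropy p - ∑ j, R j - ε)⌉₊ with hk
  set T := typicalSet p n (δ / 4)
  obtain ⟨f, G₀, hG₀T, hinj, hcol⟩ := exists_good_hash hm hp0 hp1 hR hδ n
  obtain ⟨G, hGG₀, lab, hleft, hcell, hblock⟩ := exists_blocks (2 ^ k) (by positivity) G₀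
    fun x => ((fun j => f j (x j) : ∀ j, Fin (hashSize R δ n j)), letterCount x)
  have hRj := rate_nonneg hm hp0 hR
  have hdropped : ∑ x ∈ G₀ \ G, seqDist p n x ≤ η / 3 := by
    refine le_trans ?_ hdrop
    refine (Finset.sum_le_card_nsmul _ _ _ fun x hx =>
      (seqDist_bounds_of_typical hp0 (hG₀T (Finset.mem_sdiff.mp hx).1)).2).trans ?_
    rw [nsmul_eq_mul]
    have hk' : ((2 ^ k : ℕ) : ℝ) ≤ (2 : ℝ) ^ (n * (entropy p - ∑ j, R j - ε) + 1) := by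
      push_cast
      rw [← Real.rpow_natCast]
      refine Real.rpow_le_rpow_of_exponent_le one_le_two ?_
      exact (Nat.ceil_lt_add_one (mul_nonneg (Nat.cast_nonneg n) hpos.le)).le
    have hcard : ((G₀ \ G).card : ℝ) ≤
        (2 ^ m * (2 : ℝ) ^ (n * (∑ j, R j + m * δ)) * (n + 1) ^ Fintype.card (∀ i, X i)) *
          (2 : ℝ) ^ (n * (entropy p - ∑ j, R j - ε) + 1) := by
      refine le_trans (Nat.cast_le.mpr hleft) ?_
      rw [Nat.cast_mul]
      exact mul_le_mul (card_cells_le hRj hδ.le n) hk' (by positivity) (by positivity)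
    refine (mul_le_mul_of_nonneg_right hcard (by positivity)).trans ?_
    have hexp : (2 : ℝ) ^ (n * (∑ j, R j + m * δ)) *
        (2 : ℝ) ^ (n * (entropy p - ∑ j, R j - ε) + 1) *
        (2 : ℝ) ^ (-(n * (entropy p - δ / 4))) ≤ 2 * (2 : ℝ) ^ (-(n * (ε / 2))) := by
      have h2 : 2 * (2 : ℝ) ^ (-(n * (ε / 2))) = (2 : ℝ) ^ (1 + -(n * (ε / 2))) := by
        rw [Real.rpow_add two_pos, Real.rpow_one]
      rw [h2, ← Real.rpow_add two_pos, ← Real.rpow_add two_pos]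
      refine Real.rpow_le_rpow_of_exponent_le one_le_two ?_
      have hn : (0 : ℝ) ≤ n := Nat.cast_nonneg n
      have : n * (m * δ + δ / 4) ≤ n * (ε / 2) := by
        refine mul_le_mul_of_nonneg_left ?_ hn
        rw [← hδε]
        linarith
      linarith
    calc _ = 2 ^ m * ((n : ℝ) + 1) ^ Fintype.card (∀ i, X i) *
          ((2 : ℝ) ^ (n * (∑ j, R j + m * δ)) *
          (2 : ℝ) ^ (n * (entropy p - ∑ j, R j - ε) + 1) *
          (2 : ℝ) ^ (-(n * (entropy p - δ / 4)))) := by ring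
      _ ≤ 2 ^ m * ((n : ℝ) + 1) ^ Fintype.card (∀ i, X i) *
          (2 * (2 : ℝ) ^ (-(n * (ε / 2)))) := by gcongr
      _ = _ := by ring
  have hG : ∑ x ∈ Gᶜ, seqDist p n x ≤ η := by
    have hsub : Gᶜ ⊆ Tᶜ ∪ (T \ G₀ ∪ G₀ \ G) := by
      intro x hx
      simp only [Finset.mem_union, Finset.mem_compl, Finset.mem_sdiff] at hx ⊢
      tauto
    have hnn : ∀ x : ∀ i, Fin n → X i, 0 ≤ seqDist p n x := seqDist_nonneg hp0
    have hun : ∀ s t : Finset (∀ i, Fin n → X i), ∑ x ∈ s ∪ t, seqDist p n x ≤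
        ∑ x ∈ s, seqDist p n x + ∑ x ∈ t, seqDist p n x := by
      intro s t
      rw [← Finset.sum_union_inter]
      exact le_add_of_nonneg_right (Finset.sum_nonneg fun x _ => hnn x)
    have hsum := (Finset.sum_le_sum_of_subset_of_nonneg hsub fun x _ _ => hnn x).trans
      ((hun _ _).trans (add_le_add_right (hun _ _) _))
    rw [pow_zero, mul_one] at hbad
    linarith
  refine isAccurate_of_distills (by omega) ψ hψ n k G ε hε.le ?_ ?_
  · simpa only [norm_tensorPower_sq] using hG
  · have : ∀ j, Nonempty (Fin (hashSize R δ n j)) := fun j =>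
      ⟨⟨0, Nat.ceil_pos.mpr (by positivity)⟩⟩
    have hlab : ∀ x x', lab x = lab x' →
        (∀ j, f j (x j) = f j (x' j)) ∧ letterCount x = letterCount x' := by
      intro x x' h
      have h1 := congrArg Prod.fst h
      rw [hcell, hcell, Prod.mk.injEq] at h1
      exact ⟨congrFun h1.1, h1.2⟩
    refine Distills.of_hashed_blocks (by omega) f lab _ G
      (fun x hx x' hx' => hinj x (hGG₀ hx) x' (hGG₀ hx')) ?_ ?_ ?_
    · intro x hx
      exact Set.indicator_of_notMem (by simpa using hx) _
    · intro x hx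
      rw [← hblock x hx]
      congr 1
      refine Finset.filter_congr fun x' _ => ?_
      -- The label contains the hash values, so equal labels already force equal hashes.
      exact ⟨fun h => h.2, fun h => ⟨(hlab _ _ h).1, h⟩⟩
    · intro x hx x' hx' h
      rw [Set.indicator_of_mem (by simpa using hx), Set.indicator_of_mem (by simpa using hx')]
      rw [← sq_eq_sq₀ (norm_nonneg _) (norm_nonneg _), norm_tensorPower_sq, norm_tensorPower_sq,
        seqDist_eq_prod_pow, seqDist_eq_prod_pow, (hlab x x' h).2]

lemma isAchievable_of_mem_rateRegion (hm : 2 ≤ m) (ψ : (∀ i, X i) → ℂ)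
    (hψ : ∑ x, ‖ψ x‖ ^ 2 = 1) {R : Fin m → ℝ} (hR : R ∈ rateRegion (basisDist ψ)) :
    IsAchievable ψ (entropy (basisDist ψ) - ∑ j, R j) := by
  intro ε hε
  rcases le_or_gt (entropy (basisDist ψ) - ∑ j, R j - ε) 0 with h | h
  -- When the required rate is not positive, zero copies suffice and nothing is discarded.
  · refine Filter.Eventually.of_forall fun n => ⟨0, ?_, by simpa using h⟩
    refine isAccurate_of_distills (by omega) ψ hψ n 0 Finset.univ ε hε.le ?_
      (Distills.zero_copies (by omega) _)
    rw [Finset.compl_univ, Finset.sum_empty]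
    positivity
  · filter_upwards [eventually_isAccurate hm ψ hψ hR hε h, Filter.eventually_gt_atTop 0]
      with n hn hn0
    refine ⟨_, hn, ?_⟩
    have hn0 : (0 : ℝ) < n := by exact_mod_cast hn0
    rw [le_div_iff₀ hn0, mul_comm]
    exact Nat.le_ceil _

end Achievability

end GHZ

end

theorem mainTheorem4 (m : ℕ) (hm : 2 ≤ m) (X : Fin m → Type)
    [∀ i, Fintype (X i)] [∀ i, DecidableEq (X i)]
    (ψ : (∀ i, X i) → ℂ) (hψ : ∑ x, ‖ψ x‖ ^ 2 = 1) :
    IsLeast (GHZ.sumRates (GHZ.basisDist ψ)) (GHZ.omniscienceRate (GHZ.basisDist ψ)) ∧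
      ((GHZ.entropy (GHZ.basisDist ψ) - GHZ.omniscienceRate (GHZ.basisDist ψ) : ℝ) : EReal) ≤
        GHZ.capacity ψ := by
  have hleast := GHZ.isLeast_omniscienceRate (p := GHZ.basisDist ψ) hm fun x => sq_nonneg _
  refine ⟨hleast, ?_⟩
  obtain ⟨R, hR, hsum⟩ := hleast.1
  refine le_sSup ⟨_, ?_, rfl⟩
  rw [← hsum]
  exact GHZ.isAchievable_of_mem_rateRegion hm ψ hψ hR
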